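/- **Setting.** A liquidity pool is a state machine with states $\Sigma$, initial state $s_0$, atomic actions $A$ (among them a null action $\bot$), actions $A^*$ (finite words over $A$; the empty word does nothing), admissible actions $A_s\subseteq A^*$ in each state $s$, a transition map $\tau(s,a)$ and payoffs $\pi(a)=(\Delta x,\Delta y)\in\mathbb R^2$, such that $\tau$ is an action of the monoid $A^*$, $\pi$ is additive under concatenation, $\bot$ is always admissible and changes nothing, $a_1\in A_s$ and $a_2\in A_{\tau(s,a_1)}$ imply $a_1a_2\in A_s$, and for every state $s$ and price $P>0$ there is an atomic action $a^*(s,P)\in A_s$ maximizing $\Delta x\,P+\Delta y$ over $A_s$; all the data (in particular $a^*$) are measurable. An action is null if all its letters are $\bot$. A state $s$ is a no-arbitrage state for $P$ if $\Delta x\,P+\Delta y\le 0$ for all $a\in A_s$; the pool is frictionless if for every $P>0$ there is exactly one no-arbitrage state. The external price $(P_t)_{t\ge 0}$ is a positive semimartingale on a filtered probability space, and the block times $0<t_1<t_2<\cdots\to\infty$ are deterministic. A blockchain market $B$ consists of these data and an ordering mechanism: in block $n$ the sequence of all submitted actions is permuted at random, the law of the permutation given the information at submission (which includes $P_{t_n}$)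 depending only on $n$ and on the submitted sequence; the actions are then executed in this order, starting in the state $s_n$ left by the previous block, and every action that is inadmissible in the state reached so far is dropped. A trading strategy consists of adapted holdings $(x_t,y_t)$ with $x$ predictable and $\mathbb E\int_0^t x_s^2P_s^2\,ds<\infty$, and of a sequence of actions submitted for each block using the information available at submission. It is self-financing: almost surely, for $t_n\le t<t_{n+1}$ (for $n=0$ read $0\le t<t_1$), $$\mathsf{PNL}(S)_t:=x_tP_t+y_t-(x_0P_0+y_0)=\int_0^t x_s\,dP_s+\sum_{i=1}^n\sum_j(\Delta x_{i,j}P_{t_i}+\Delta y_{i,j}),$$ the inner sum being over the payoffs of its actions executed in block $i$. A family of $m$ strategies operating in the same world is *competitive* if (a) all executed on-chain actions are theirs; (b) their total risky holding is identically $0$; (c) after each block $n$ the pool is in a no-arbitrage state for $P_{t_n}$; and (d) $m=1$, or almost surely every strategy submits, for at least one block, a non-null action admissible in the state at the beginning of that block, and for infinitely many blocks at least two of the strategies do so. $\mathsf{MEV}^{\mathrm{pw}}_m(B)_t$ is the essential supremum of $\sum_{S\in\mathcal S}\mathsf{PNL}(S)_t$ over all competitive families $\mathcal S$ of $m$ or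 more strategies. $S_0$ is the self-financing strategy with $x\equiv 0$ that submits $a^*(s_n,P_{t_n})$ in each block $n$, and $\mathsf{PNL}^*(S_0)$ is its PNL when nobody else submits on-chain actions. **Theorem.** Let the pool be frictionless. Let $m\ge1$; if $m\ge 2$, assume that almost surely $S_0$, when alone, submits a non-null action in infinitely many blocks. Then there is a competitive family $\mathcal S$ of $m$ strategies such that, for every $t\ge 0$, almost surely $$\mathsf{MEV}^{\mathrm{pw}}_m(B)_t=\sum_{S\in\mathcal S}\mathsf{PNL}(S)_t=\mathsf{PNL}^*(S_0)_t .$$ This process is, up to null sets for each $t$, the same for all such $m$ and for all ordering mechanisms (and filtrations) with the same pool, price process and block times. -/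

import Mathlib

open MeasureTheory ProbabilityTheory Filter Topology Set
open scoped NNReal ENNReal

namespace MEV

/-! ### Measurable structure on finite sequences and on permutations -/

/-- Finite sequences carry the σ-algebra of the disjoint union of the spaces `Fin k → α`. -/
instance instMeasurableSpaceList {α : Type*} [MeasurableSpace α] : MeasurableSpace (List α) :=
  MeasurableSpace.comap (fun l : List α => (⟨l.length, l.get⟩ : Σ k : ℕ, Fin k → α)) inferInstance

instance instMeasurableSpaceFreeMonoid {α : Type*} [MeasurableSpace α] :
    MeasurableSpace (FreeMonoid α) :=
  MeasurableSpace.comap FreeMonoid.toList inferInstance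

/-- Permutations of a finite set: every subset is measurable. -/
instance instMeasurableSpacePermFin (k : ℕ) : MeasurableSpace (Equiv.Perm (Fin k)) := ⊤

/-! ### Semimartingales and the stochastic integral -/

section StochasticIntegral

variable {Ω : Type*} [mΩ : MeasurableSpace Ω]

/-- An elementary integrand `∑ i, coef i · 1_{(left i, right i]}`, where `coef i` is bounded and
known at time `left i`. -/
structure ElementaryIntegrand (𝓕 : Filtration ℝ≥0 mΩ) where
  size : ℕ
  left : Fin size → ℝ≥0
  right : Fin size → ℝ≥0
  left_le_right : ∀ i, left i ≤ right i
  coef : Fin size → Ω → ℝ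
  measurable_coef : ∀ i, Measurable[𝓕 (left i)] (coef i)
  bounded_coef : ∃ C : ℝ, ∀ i ω, |coef i ω| ≤ C

/-- The process described by an elementary integrand. -/
noncomputable def ElementaryIntegrand.eval {𝓕 : Filtration ℝ≥0 mΩ} (H : ElementaryIntegrand 𝓕)
    (s : ℝ≥0) (ω : Ω) : ℝ :=
  ∑ i, (Ioc (H.left i) (H.right i)).indicator (fun _ => H.coef i ω) s

/-- The integral of an elementary integrand against `X` over `(0, t]`. -/
noncomputable def ElementaryIntegrand.integral {𝓕 : Filtration ℝ≥0 mΩ} (H : ElementaryIntegrand 𝓕)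
    (X : ℝ≥0 → Ω → ℝ) (t : ℝ≥0) (ω : Ω) : ℝ :=
  ∑ i, H.coef i ω * (X (min (H.right i) t) ω - X (min (H.left i) t) ω)

/-- Semimartingales: adapted càdlàg processes that are good integrators, i.e. for every horizon `t`
the elementary integral over `(0, t]` is continuous from the uniform norm to convergence in
probability. (By the Bichteler–Dellacherie theorem these are the processes that are the sum of a
local martingale and an adapted càdlàg process of finite variation.) -/
structure IsSemimartingale (μ : Measure Ω) (𝓕 : Filtration ℝ≥0 mΩ) (X : ℝ≥0 → Ω → ℝ) : Prop where
  adapted : Adapted 𝓕 X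
  right_continuous : ∀ᵐ ω ∂μ, ∀ t, ContinuousWithinAt (fun s => X s ω) (Ici t) t
  left_limits : ∀ᵐ ω ∂μ, ∀ t, ∃ l, Tendsto (fun s => X s ω) (𝓝[<] t) (𝓝 l)
  good_integrator : ∀ (t : ℝ≥0) (H : ℕ → ElementaryIntegrand 𝓕),
    (∀ ε : ℝ, 0 < ε → ∀ᶠ n in atTop, ∀ s ω, |(H n).eval s ω| ≤ ε) →
      TendstoInMeasure μ (fun n => (H n).integral X t) atTop (fun _ => 0)

/-- `F` is dominated on `(0, t]`, outside a null set of paths, by `sup_k |h k|`. -/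
def DominatedOn (μ : Measure Ω) {𝓕 : Filtration ℝ≥0 mΩ} (t : ℝ≥0) (F : ℝ≥0 → Ω → ℝ)
    (h : ℕ → ElementaryIntegrand 𝓕) : Prop :=
  ∀ᵐ ω ∂μ, ∀ s ∈ Ioc 0 t, ‖F s ω‖ₑ ≤ ⨆ k, ‖(h k).eval s ω‖ₑ

/-- The Daniell mean of the integrator `X` on `(0, t]` for convergence in probability:
the infimum, over the suprema `h` of sequences of elementary integrands with `|F| ≤ h`, of
`sup { E[1 ∧ |∫₀ᵗ Y dX|] : Y elementary, |Y| ≤ h }`. -/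
noncomputable def daniellMean (μ : Measure Ω) (𝓕 : Filtration ℝ≥0 mΩ) (X : ℝ≥0 → Ω → ℝ) (t : ℝ≥0)
    (F : ℝ≥0 → Ω → ℝ) : ℝ≥0∞ :=
  ⨅ (h : ℕ → ElementaryIntegrand 𝓕) (_ : DominatedOn μ t F h),
    ⨆ (Y : ElementaryIntegrand 𝓕) (_ : DominatedOn μ t Y.eval h),
      ∫⁻ ω, min 1 ‖Y.integral X t ω‖ₑ ∂μ

/-- The random variable `I` is (a version of) the stochastic integral `∫₀ᵗ F dX`: `F` is a limit of
elementary integrands in the Daniell mean, and `I` is the limit in probability of their integrals.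
(This is Bichteler's construction; the class of predictable processes that are integrable on every
`(0, t]` is the usual class `L(X)`.) -/
def HasStochIntegral (μ : Measure Ω) (𝓕 : Filtration ℝ≥0 mΩ) (X : ℝ≥0 → Ω → ℝ)
    (F : ℝ≥0 → Ω → ℝ) (t : ℝ≥0) (I : Ω → ℝ) : Prop :=
  ∃ H : ℕ → ElementaryIntegrand 𝓕,
    Tendsto (fun n => daniellMean μ 𝓕 X t (fun s ω => F s ω - (H n).eval s ω)) atTop (𝓝 0) ∧
      TendstoInMeasure μ (fun n => (H n).integral X t) atTop I

end StochasticIntegral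

/-! ### Liquidity pools -/

/-- A liquidity pool with state space `St` and atomic action space `A`. Actions (trades) are the
elements of the free monoid on `A`; the empty word stands for doing nothing. -/
structure LiquidityPool (St A : Type*) [MeasurableSpace St] [MeasurableSpace A] where
  /-- the admissible actions `A_s` in a state `s` -/
  adm : St → Set (FreeMonoid A)
  /-- the transition function `τ` -/
  trans : St → FreeMonoid A → St
  /-- the payoff `(Δx, Δy)` of an action -/
  payoff : FreeMonoid A → ℝ × ℝ
  /-- the initial state -/
  init : St
  one_mem_adm : ∀ s, 1 ∈ adm s
  trans_one : ∀ s, trans s 1 = s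
  payoff_one : payoff 1 = 0
  /-- the null action -/
  null : A
  null_mem_adm : ∀ s, FreeMonoid.of null ∈ adm s
  trans_null : ∀ s, trans s (FreeMonoid.of null) = s
  payoff_null : payoff (FreeMonoid.of null) = 0
  mul_mem_adm : ∀ s v w, v ∈ adm s → w ∈ adm (trans s v) → v * w ∈ adm s
  trans_mul : ∀ s v w, trans s (v * w) = trans (trans s v) w
  payoff_mul : ∀ v w, payoff (v * w) = payoff v + payoff w
  /-- the atomic optimal action `a*(s, P)` -/
  opt : St → ℝ → A
  opt_mem_adm : ∀ s P, 0 < P → FreeMonoid.of (opt s P) ∈ adm s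
  opt_max : ∀ s P, 0 < P → ∀ w ∈ adm s,
    (payoff w).1 * P + (payoff w).2 ≤
      (payoff (FreeMonoid.of (opt s P))).1 * P + (payoff (FreeMonoid.of (opt s P))).2
  measurable_opt : Measurable (Function.uncurry opt)
  measurable_trans : Measurable (fun p : St × A => trans p.1 (FreeMonoid.of p.2))
  measurable_payoff : Measurable (fun a : A => payoff (FreeMonoid.of a))

namespace LiquidityPool

variable {St A : Type*} [MeasurableSpace St] [MeasurableSpace A] (pool : LiquidityPool St A)

/-- The value `Δx P + Δy` of an action at external price `P`. -/
noncomputable def value (P : ℝ) (w : FreeMonoid A) : ℝ := (pool.payoff w).1 * P + (pool.payoff w).2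

/-- `s` is a no-arbitrage state relative to the price `P`. -/
def IsNoArbitrage (P : ℝ) (s : St) : Prop := ∀ w ∈ pool.adm s, pool.value P w ≤ 0

/-- For every (positive) price there is exactly one no-arbitrage state. -/
def Frictionless : Prop := ∀ P : ℝ, 0 < P → ∃! s, pool.IsNoArbitrage P s

/-- An action is null if it is a composition of null actions. -/
def IsNull (w : FreeMonoid A) : Prop := ∀ a ∈ w.toList, a = pool.null

open Classical in
/-- The executed trades when the labelled trades of a list are processed in order from state `s`
and every trade that is inadmissible in the state reached so far is dropped. -/
noncomputable def execute {ι : Type*} : St → List (ι × FreeMonoid A) → List (ι × FreeMonoid A)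
  | _, [] => []
  | s, e :: l => if e.2 ∈ pool.adm s then e :: execute (pool.trans s e.2) l else execute s l

/-- The state reached from `s` after a list of executed trades. -/
def stateAfter {ι : Type*} (s : St) (l : List (ι × FreeMonoid A)) : St :=
  l.foldl (fun s e => pool.trans s e.2) s

/-- The state before the `n`-th block (counted from `0`) if the only trade of each block is the
optimal action at the price `P (τ n)` of that block. -/
def optState {Ω : Type*} (P : ℝ≥0 → Ω → ℝ) (τ : ℕ → ℝ≥0) : ℕ → Ω → St
  | 0, _ => pool.init
  | n + 1, ω =>
    pool.trans (optState P τ n ω) (FreeMonoid.of (pool.opt (optState P τ n ω) (P (τ n) ω)))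

end LiquidityPool

/-! ### Blockchain markets -/

/-- Deterministic block times; `τ n` is the time of the block with number `n + 1`. -/
structure IsBlockTimes (τ : ℕ → ℝ≥0) : Prop where
  pos : 0 < τ 0
  strictMono : StrictMono τ
  unbounded : Tendsto τ atTop atTop

/-- A blockchain market on the probability space `(Ω, μ)` for a given pool, external price process
`P` and deterministic block times `τ`. -/
structure BlockchainMarket {Ω St A : Type*} [mΩ : MeasurableSpace Ω] [MeasurableSpace St]
    [MeasurableSpace A] (μ : Measure Ω) (pool : LiquidityPool St A) (P : ℝ≥0 → Ω → ℝ)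
    (τ : ℕ → ℝ≥0) where
  /-- information available at each time -/
  filt : Filtration ℝ≥0 mΩ
  semimartingale : IsSemimartingale μ filt P
  /-- information available when the trades for block `n` are submitted: everything known at time
  `τ n`, including the price, except for the outcome of the ordering of that block -/
  info : ℕ → MeasurableSpace Ω
  info_le : ∀ n, info n ≤ filt (τ n)
  le_info : ∀ n s, s < τ n → filt s ≤ info n
  price_info : ∀ n, Measurable[info n] (P (τ n))
  /-- the ordering mechanism: for each block and each sequence of submitted trades, a probability
  distribution over the permutations of the sequence -/
  law : ℕ → (k : ℕ) → Kernel (Fin k → FreeMonoid A) (Equiv.Perm (Fin k))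
  isMarkov_law : ∀ n k, IsMarkovKernel (law n k)
  /-- the permutation that is drawn for block `n` if the sequence `T` is submitted -/
  draw : ℕ → (k : ℕ) → (Fin k → FreeMonoid A) → Ω → Equiv.Perm (Fin k)
  measurable_draw : ∀ n k,
    Measurable[MeasurableSpace.prod MeasurableSpace.pi (filt (τ n))]
      (fun p : (Fin k → FreeMonoid A) × Ω => draw n k p.1 p.2)
  /-- conditionally on the information at submission, the permutation has the prescribed law -/
  draw_law : ∀ (n k : ℕ) (T : Ω → Fin k → FreeMonoid A), Measurable[info n] T →
    ∀ G : Set Ω, MeasurableSet[info n] G → ∀ σ : Equiv.Perm (Fin k),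
      μ (G ∩ {ω | draw n k (T ω) ω = σ}) = ∫⁻ ω in G, law n k (T ω) {σ} ∂μ

/-! ### Trading strategies -/

/-- The data of a trading strategy: holdings `x` of the risky asset and `y` of the numéraire, and
the sequence of on-chain trades submitted for each block. -/
structure TradingStrategy (Ω A : Type*) where
  x : ℝ≥0 → Ω → ℝ
  y : ℝ≥0 → Ω → ℝ
  trades : ℕ → Ω → List (FreeMonoid A)

/-- The sum of finitely many strategies. -/
noncomputable def TradingStrategy.sum {Ω A : Type*} {m : ℕ} (S : Fin m → TradingStrategy Ω A) :
    TradingStrategy Ω A where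
  x t ω := ∑ i, (S i).x t ω
  y t ω := ∑ i, (S i).y t ω
  trades n ω := (List.finRange m).flatMap fun i => (S i).trades n ω

/-- The PNL process of a strategy. -/
noncomputable def TradingStrategy.pnl {Ω A : Type*} (S : TradingStrategy Ω A) (P : ℝ≥0 → Ω → ℝ)
    (t : ℝ≥0) (ω : Ω) : ℝ :=
  S.x t ω * P t ω + S.y t ω - (S.x 0 ω * P 0 ω + S.y 0 ω)

/-- All that is submitted on chain in one world: a family of `m` strategies and the trades of all
other participants. -/
structure World (Ω A : Type*) (m : ℕ) where
  strat : Fin m → TradingStrategy Ω A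
  others : ℕ → Ω → List (FreeMonoid A)

namespace World

variable {Ω A : Type*} {m : ℕ}

/-- The world in which `S` is the only strategy submitting on-chain trades. -/
def alone (S : TradingStrategy Ω A) : World Ω A 1 where
  strat _ := S
  others _ _ := []

/-- The sequence of trades submitted for block `n`, each labelled by the strategy that submitted
it (`none` for the other participants). Since every trade has one label, the executed trades of the
strategies of a world are disjoint: they are concurrent. -/
def submitted (W : World Ω A m) (n : ℕ) (ω : Ω) : List (Option (Fin m) × FreeMonoid A) :=
  (W.others n ω).map (fun w => (none, w)) ++
    (List.finRange m).flatMap fun i => ((W.strat i).trades n ω).map fun w => (some i, w)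

/-- The total PNL of a family. -/
noncomputable def totalPNL (W : World Ω A m) (P : ℝ≥0 → Ω → ℝ) (t : ℝ≥0) (ω : Ω) : ℝ :=
  ∑ i, (W.strat i).pnl P t ω

end World

namespace BlockchainMarket

variable {Ω St A : Type*} [mΩ : MeasurableSpace Ω] [MeasurableSpace St] [MeasurableSpace A]
  {μ : Measure Ω} {pool : LiquidityPool St A} {P : ℝ≥0 → Ω → ℝ} {τ : ℕ → ℝ≥0}
  (B : BlockchainMarket μ pool P τ) {m : ℕ}

/-- The submitted trades of block `n` in the order chosen by the ordering mechanism. -/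
def ordered (W : World Ω A m) (n : ℕ) (ω : Ω) : List (Option (Fin m) × FreeMonoid A) :=
  List.ofFn fun j => (W.submitted n ω).get
    (B.draw n (W.submitted n ω).length (fun i => ((W.submitted n ω).get i).2) ω j)

/-- The pool state before block `n` (counted from `0`). -/
noncomputable def state (W : World Ω A m) : ℕ → Ω → St
  | 0, _ => pool.init
  | n + 1, ω => pool.stateAfter (state W n ω) (pool.execute (state W n ω) (B.ordered W n ω))

/-- The trades executed in block `n`, in order. -/
noncomputable def executed (W : World Ω A m) (n : ℕ) (ω : Ω) :
    List (Option (Fin m) × FreeMonoid A) :=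
  pool.execute (B.state W n ω) (B.ordered W n ω)

/-- The value at the current price of the trades executed by strategy `i` in block `n`. -/
noncomputable def blockGain (W : World Ω A m) (i : Fin m) (n : ℕ) (ω : Ω) : ℝ :=
  (((B.executed W n ω).filter fun e => e.1 = some i).map
    fun e => pool.value (P (τ n) ω) e.2).sum

/-- Strategies are adapted, their risky holdings are predictable and satisfy the integrability
condition, and the trades for a block are submitted with the information available for it. -/
structure IsStrategy (S : TradingStrategy Ω A) : Prop where
  predictable_x : IsStronglyPredictable B.filt S.x
  adapted_y : Adapted B.filt S.y
  measurable_trades : ∀ n, Measurable[B.info n] (S.trades n)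
  integrable : ∀ t : ℝ≥0, ∫⁻ ω, (∫⁻ s in Icc (0 : ℝ) t,
    ENNReal.ofReal (S.x s.toNNReal ω ^ 2 * P s.toNNReal ω ^ 2)) ∂μ < ∞

/-- The self-financing condition for strategy `i`; `N` is the number of blocks up to time `t`. -/
def SelfFinancing (W : World Ω A m) (i : Fin m) : Prop :=
  ∀ (t : ℝ≥0) (N : ℕ), (∀ n, τ n ≤ t ↔ n < N) →
    ∃ I : Ω → ℝ, HasStochIntegral μ B.filt P (W.strat i).x t I ∧
      ∀ᵐ ω ∂μ, (W.strat i).x t ω * P t ω + (W.strat i).y t ω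
        - ((W.strat i).x 0 ω * P 0 ω + (W.strat i).y 0 ω)
        = I ω + ∑ n ∈ Finset.range N, B.blockGain W i n ω

/-- The members of the family are self-financing trading strategies in the world `W`. -/
structure IsValid (W : World Ω A m) : Prop where
  isStrategy : ∀ i, B.IsStrategy (W.strat i)
  selfFinancing : ∀ i, B.SelfFinancing W i
  measurable_others : ∀ n, Measurable[B.info n] (W.others n)

/-- An arbitrage strategy never holds the risky asset. -/
def IsArbitrage (μ : Measure Ω) (S : TradingStrategy Ω A) : Prop :=
  ∀ᵐ ω ∂μ, ∀ t, S.x t ω = 0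

/-- The (concurrent) family executes all on-chain trades. -/
def Covering (W : World Ω A m) : Prop :=
  ∀ n, ∀ᵐ ω ∂μ, ∀ e ∈ B.executed W n ω, e.1 ≠ none

/-- The family is covering and its sum is an arbitrage strategy. -/
def Complete (W : World Ω A m) : Prop :=
  B.Covering W ∧ IsArbitrage μ (TradingStrategy.sum W.strat)

/-- Strategy `i` submits a non-null admissible trade for block `n`. -/
def Submits (W : World Ω A m) (i : Fin m) (n : ℕ) (ω : Ω) : Prop :=
  ∃ w ∈ (W.strat i).trades n ω, w ∈ pool.adm (B.state W n ω) ∧ ¬ pool.IsNull w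

/-- Competitive families of strategies. -/
structure IsCompetitive (W : World Ω A m) : Prop where
  valid : B.IsValid W
  complete : B.Complete W
  noArbitrage : ∀ n, ∀ᵐ ω ∂μ, pool.IsNoArbitrage (P (τ n) ω) (B.state W (n + 1) ω)
  active : m = 1 ∨ ∀ᵐ ω ∂μ, (∀ i, ∃ n, B.Submits W i n ω) ∧
    ∃ᶠ n in atTop, ∃ i j, i ≠ j ∧ B.Submits W i n ω ∧ B.Submits W j n ω

/-- `V` is the `m`-player competitive pathwise MEV: for each time `t`, the random variable `V t` is
the (essential) supremum of the total PNL at time `t` over all competitive families of `m` or more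
strategies. -/
def IsPathwiseMEV (m : ℕ) (V : ℝ≥0 → Ω → EReal) : Prop :=
  ∀ t, AEMeasurable (V t) μ ∧
    (∀ k, m ≤ k → ∀ W : World Ω A k, B.IsCompetitive W →
      ∀ᵐ ω ∂μ, ((W.totalPNL P t ω : ℝ) : EReal) ≤ V t ω) ∧
    ∀ U : Ω → EReal, AEMeasurable U μ →
      (∀ k, m ≤ k → ∀ W : World Ω A k, B.IsCompetitive W →
        ∀ᵐ ω ∂μ, ((W.totalPNL P t ω : ℝ) : EReal) ≤ U ω) →
      ∀ᵐ ω ∂μ, V t ω ≤ U ω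

/-- `S` is the simple arbitrage strategy run uncontested: the self-financing arbitrage strategy
that is alone on chain and submits the optimal action in every block. Its `pnl` is then its
uncontested PNL. -/
structure IsSimpleArbitrageAlone (S : TradingStrategy Ω A) : Prop where
  valid : B.IsValid (World.alone S)
  isArbitrage : IsArbitrage μ S
  trades_eq : ∀ n, ∀ᵐ ω ∂μ, S.trades n ω =
    [FreeMonoid.of (pool.opt (B.state (World.alone S) n ω) (P (τ n) ω))]

end BlockchainMarket

end MEV

/-! After each block of a competitive family the pool is in a no-arbitrage state, and in a
frictionless pool the price alone determines that state. So the state before every block is the same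
for all competitive families, namely `optState` (`state_eq_optState`). The trades executed in a
block compose to one admissible action in that state (`exists_mem_adm_execute`), hence are worth at
most the optimal action there. Summing over blocks bounds the on-chain gains by `arbitragePNL`,
which involves neither the number of players nor the ordering nor the filtration.

The bound is attained when every strategy submits the optimal action in every block and never holds
the risky asset. Whatever the order, the trade executed first takes the whole value and leaves a
no-arbitrage state, in which the remaining copies are dropped or worth nothing
(`executed_of_forall_opt`). The draw only decides who is paid.

It remains to see that off-chain holdings contribute nothing in total: integrals of integrands that
sum to zero sum to zero (`sum_hasStochIntegral_eq_zero`). The integral is a Daniell extension, and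
this is the bulk of the work. If each `F i` is approximated by elementary `H i`, then `∑ H i` is
dominated by `∑ |F i - H i|`, and an elementary integrand below finitely many processes of small
Daniell mean must have a small integral in probability (`mean_le_of_dominated_sum`). This follows
from subadditivity on elementary integrands (`mean_le_sum`) and continuity along sequences
decreasing to zero (`tendsto_mean_of_antitone_abs`).

The latter is Dini's argument on each path. Elementary paths can jump just after grid points, so
short intervals to the right of these points are cut out first. That this costs little
(`exists_mean_le_of_abs_le_Ioc`) rests on choosing signs and comparing characteristic functions
(`mean_tendsto_zero_of_sum_abs_le`). -/

namespace MEV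

/-! ### The pathwise integral of step functions -/

lemma eventually_indicator_Ioc_eq (l r p : ℝ≥0) (c : ℝ) :
    ∀ᶠ q in 𝓝[>] p, (Ioc l r).indicator (fun _ => c) q = (Ico l r).indicator (fun _ => c) p := by
  have h1 : ∀ᶠ q in 𝓝[>] p, (l < q ↔ l ≤ p) := by
    by_cases h : l ≤ p
    · filter_upwards [self_mem_nhdsWithin] with q hq
      exact ⟨fun _ => h, fun _ => h.trans_lt hq⟩
    · filter_upwards [mem_nhdsWithin_of_mem_nhds (Iio_mem_nhds (not_le.1 h))] with q hq
      exact ⟨fun h' => absurd h' (not_lt.2 (le_of_lt hq)), fun h' => absurd h' h⟩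
  have h2 : ∀ᶠ q in 𝓝[>] p, (q ≤ r ↔ p < r) := by
    by_cases h : p < r
    · filter_upwards [mem_nhdsWithin_of_mem_nhds (Iio_mem_nhds h)] with q hq
      exact ⟨fun _ => h, fun _ => le_of_lt hq⟩
    · filter_upwards [self_mem_nhdsWithin] with q hq
      exact ⟨fun h' => absurd ((show p < q from hq).trans_le h') h, fun h' => absurd h' h⟩
  filter_upwards [h1, h2] with q hq1 hq2
  simp only [indicator, mem_Ioc, mem_Ico, hq1, hq2]

/-- The coefficient of `g p` in the sum is the value of the step function at `p` minus its right
limit there, so it vanishes with the step function. Hence an elementary integral depends only on the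
integrand and not on the way it is written as a sum. -/
lemma sum_increment_eq_zero {ι : Type*} [Fintype ι] {l r : ι → ℝ≥0} (hlr : ∀ i, l i ≤ r i)
    {c : ι → ℝ} (h : ∀ s, ∑ i, (Ioc (l i) (r i)).indicator (fun _ => c i) s = 0) (g : ℝ≥0 → ℝ) :
    ∑ i, c i * (g (r i) - g (l i)) = 0 := by
  classical
  have key : ∀ p, ∑ i, c i * ((if r i = p then 1 else 0) - (if l i = p then 1 else 0)) = 0 := by
    intro p
    -- Just to the right of `p` the indicator of `(l, r]` takes the value at `p` of the indicator of
    -- `[l, r)`; a nearby `q` thus evaluates the right limit.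
    have hev : ∀ᶠ q in 𝓝[>] p, ∀ i, (Ioc (l i) (r i)).indicator (fun _ => c i) q
        = (Ico (l i) (r i)).indicator (fun _ => c i) p :=
      eventually_all.2 fun i => eventually_indicator_Ioc_eq (l i) (r i) p (c i)
    obtain ⟨q, hq⟩ := hev.exists
    have h2 : ∑ i, (Ico (l i) (r i)).indicator (fun _ => c i) p = 0 := by
      rw [← h q]
      exact Finset.sum_congr rfl fun i _ => (hq i).symm
    refine Eq.trans ?_ ((congrArg₂ (· - ·) (h p) h2).trans (sub_self 0))
    rw [← Finset.sum_sub_distrib]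
    refine Finset.sum_congr rfl fun i _ => ?_
    have := hlr i
    simp only [indicator, mem_Ioc, mem_Ico]
    rcases lt_trichotomy (l i) p with h1 | h1 | h1 <;> rcases lt_trichotomy (r i) p with h3 | h3 | h3
    all_goals
      first
      | exact absurd (h3.trans h1) (not_lt.2 this)
      | skip
    all_goals
      first
      | (subst h1; simp_all [le_of_lt, ne_of_gt, not_le_of_gt])
      | simp_all [le_of_lt, ne_of_gt, ne_of_lt, not_le_of_gt, not_lt_of_gt]
  let G : Finset ℝ≥0 := Finset.univ.image l ∪ Finset.univ.image r
  have hr : ∀ i, r i ∈ G := fun i => by simp [G]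
  have hl : ∀ i, l i ∈ G := fun i => by simp [G]
  calc ∑ i, c i * (g (r i) - g (l i))
      = ∑ i, ∑ p ∈ G, g p * (c i * ((if r i = p then 1 else 0) - (if l i = p then 1 else 0))) := by
        refine Finset.sum_congr rfl fun i _ => ?_
        have e1 : ∑ p ∈ G, g p * (if r i = p then 1 else 0) = g (r i) := by simp [hr i]
        have e2 : ∑ p ∈ G, g p * (if l i = p then 1 else 0) = g (l i) := by simp [hl i]
        rw [← e1, ← e2, ← Finset.sum_sub_distrib, Finset.mul_sum]
        exact Finset.sum_congr rfl fun p _ => by ring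
    _ = ∑ p ∈ G, g p * 0 := by
        rw [Finset.sum_comm]
        refine Finset.sum_congr rfl fun p _ => ?_
        rw [← Finset.mul_sum, key p]
    _ = 0 := by simp

lemma indicator_Ioc_min (l r t s : ℝ≥0) (c : ℝ) :
    (Ioc (min l t) (min r t)).indicator (fun _ => c) s
      = (Ioc 0 t).indicator ((Ioc l r).indicator fun _ => c) s := by
  have : Ioc (min l t) (min r t) = Ioc 0 t ∩ Ioc l r := by
    ext s
    simp only [mem_Ioc, mem_inter_iff, min_lt_iff, le_min_iff]
    constructor
    · rintro ⟨h1 | h1, h2, h3⟩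
      · exact ⟨⟨pos_of_gt h1, h3⟩, h1, h2⟩
      · exact absurd h1 (not_lt.2 h3)
    · rintro ⟨⟨_, h1⟩, h2, h3⟩
      exact ⟨Or.inl h2, h3, h1⟩
  rw [this, ← indicator_indicator]

lemma sum_stopped_increment_eq_zero {ι : Type*} [Fintype ι] {l r : ι → ℝ≥0} (hlr : ∀ i, l i ≤ r i)
    {c : ι → ℝ} {t : ℝ≥0}
    (h : ∀ s ∈ Ioc 0 t, ∑ i, (Ioc (l i) (r i)).indicator (fun _ => c i) s = 0) (g : ℝ≥0 → ℝ) :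
    ∑ i, c i * (g (min (r i) t) - g (min (l i) t)) = 0 := by
  refine sum_increment_eq_zero (fun i => min_le_min_right t (hlr i)) (fun s => ?_) g
  simp only [indicator_Ioc_min]
  by_cases hs : s ∈ Ioc 0 t
  · simpa [indicator_of_mem hs] using h s hs
  · simp [indicator_of_notMem hs]

/-! ### The vector lattice of elementary integrands -/

section Elementary

variable {Ω : Type*} [mΩ : MeasurableSpace Ω] {𝓕 : Filtration ℝ≥0 mΩ}

namespace ElementaryIntegrand

/-- An elementary integrand with an arbitrary finite index type. -/
noncomputable def ofFintype {ι : Type*} [Fintype ι] (l r : ι → ℝ≥0) (hlr : ∀ i, l i ≤ r i)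
    (c : ι → Ω → ℝ) (hc : ∀ i, Measurable[𝓕 (l i)] (c i)) (hb : ∃ C : ℝ, ∀ i ω, |c i ω| ≤ C) :
    ElementaryIntegrand 𝓕 where
  size := Fintype.card ι
  left i := l ((Fintype.equivFin ι).symm i)
  right i := r ((Fintype.equivFin ι).symm i)
  left_le_right _ := hlr _
  coef i := c ((Fintype.equivFin ι).symm i)
  measurable_coef _ := hc _
  bounded_coef := hb.imp fun _ h _ ω => h _ ω

lemma eval_ofFintype {ι : Type*} [Fintype ι] (l r : ι → ℝ≥0) (hlr : ∀ i, l i ≤ r i)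
    (c : ι → Ω → ℝ) (hc : ∀ i, Measurable[𝓕 (l i)] (c i)) (hb : ∃ C : ℝ, ∀ i ω, |c i ω| ≤ C)
    (s : ℝ≥0) (ω : Ω) :
    (ofFintype l r hlr c hc hb).eval s ω = ∑ i, (Ioc (l i) (r i)).indicator (fun _ => c i ω) s :=
  (Fintype.equivFin ι).symm.sum_comp fun i => (Ioc (l i) (r i)).indicator (fun _ => c i ω) s

lemma integral_ofFintype {ι : Type*} [Fintype ι] (l r : ι → ℝ≥0) (hlr : ∀ i, l i ≤ r i)
    (c : ι → Ω → ℝ) (hc : ∀ i, Measurable[𝓕 (l i)] (c i)) (hb : ∃ C : ℝ, ∀ i ω, |c i ω| ≤ C)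
    (X : ℝ≥0 → Ω → ℝ) (t : ℝ≥0) (ω : Ω) :
    (ofFintype l r hlr c hc hb).integral X t ω
      = ∑ i, c i ω * (X (min (r i) t) ω - X (min (l i) t) ω) :=
  (Fintype.equivFin ι).symm.sum_comp fun i => c i ω * (X (min (r i) t) ω - X (min (l i) t) ω)

/-- Linear combinations of two elementary integrands. -/
noncomputable def lin (a : ℝ) (H : ElementaryIntegrand 𝓕) (b : ℝ) (K : ElementaryIntegrand 𝓕) :
    ElementaryIntegrand 𝓕 :=
  ofFintype (Sum.elim H.left K.left) (Sum.elim H.right K.right)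
    (by rintro (i | i); exacts [H.left_le_right i, K.left_le_right i])
    (Sum.elim (fun i ω => a * H.coef i ω) (fun i ω => b * K.coef i ω))
    (by
      rintro (i | i)
      exacts [(H.measurable_coef i).const_mul a, (K.measurable_coef i).const_mul b])
    (by
      obtain ⟨C, hC⟩ := H.bounded_coef
      obtain ⟨D, hD⟩ := K.bounded_coef
      refine ⟨max (|a| * C) (|b| * D), ?_⟩
      rintro (i | i) ω
      · simp only [Sum.elim_inl, abs_mul]
        exact le_max_of_le_left (mul_le_mul_of_nonneg_left (hC i ω) (abs_nonneg a))
      · simp only [Sum.elim_inr, abs_mul]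
        exact le_max_of_le_right (mul_le_mul_of_nonneg_left (hD i ω) (abs_nonneg b)))

@[simp] lemma eval_lin (a : ℝ) (H : ElementaryIntegrand 𝓕) (b : ℝ) (K : ElementaryIntegrand 𝓕)
    (s : ℝ≥0) (ω : Ω) : (lin a H b K).eval s ω = a * H.eval s ω + b * K.eval s ω := by
  rw [lin, eval_ofFintype]
  simp only [Fintype.sum_sum_type, Sum.elim_inl, Sum.elim_inr, eval,
    Finset.mul_sum, indicator, mul_ite, mul_zero]
  congr!

@[simp] lemma integral_lin (a : ℝ) (H : ElementaryIntegrand 𝓕) (b : ℝ) (K : ElementaryIntegrand 𝓕)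
    (X : ℝ≥0 → Ω → ℝ) (t : ℝ≥0) (ω : Ω) :
    (lin a H b K).integral X t ω = a * H.integral X t ω + b * K.integral X t ω := by
  rw [lin, integral_ofFintype]
  simp only [Fintype.sum_sum_type, Sum.elim_inl, Sum.elim_inr, integral,
    Finset.mul_sum, mul_assoc]

/-- The zero integrand. -/
def zero (𝓕 : Filtration ℝ≥0 mΩ) : ElementaryIntegrand 𝓕 where
  size := 0
  left := Fin.elim0
  right := Fin.elim0
  left_le_right i := i.elim0
  coef := Fin.elim0
  measurable_coef i := i.elim0
  bounded_coef := ⟨0, fun i => i.elim0⟩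

@[simp] lemma eval_zero (s : ℝ≥0) (ω : Ω) : (zero 𝓕).eval s ω = 0 := by
  simp only [eval]
  exact Finset.sum_eq_zero fun i _ => i.elim0

lemma integral_eq_zero {H : ElementaryIntegrand 𝓕} {t : ℝ≥0} {ω : Ω}
    (h : ∀ s ∈ Ioc 0 t, H.eval s ω = 0) (X : ℝ≥0 → Ω → ℝ) : H.integral X t ω = 0 :=
  sum_stopped_increment_eq_zero H.left_le_right (c := fun i => H.coef i ω) h (fun s => X s ω)

/-- The combination `L - a H - b K` vanishes on `(0, t]`, so its integral does. Only the single path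
`ω` is involved, and the representations of the integrands play no role. -/
lemma integral_lin_of_eval {H K L : ElementaryIntegrand 𝓕} {t : ℝ≥0} {ω : Ω} {a b : ℝ}
    (h : ∀ s ∈ Ioc 0 t, L.eval s ω = a * H.eval s ω + b * K.eval s ω) (X : ℝ≥0 → Ω → ℝ) :
    L.integral X t ω = a * H.integral X t ω + b * K.integral X t ω := by
  have := integral_eq_zero (H := lin 1 L (-1) (lin a H b K)) (t := t) (ω := ω)
    (fun s hs => by simp [h s hs]) X
  simp only [integral_lin] at this
  linarith

lemma exists_abs_eval_le (H : ElementaryIntegrand 𝓕) : ∃ C : ℝ, 0 ≤ C ∧ ∀ s ω, |H.eval s ω| ≤ C := by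
  obtain ⟨C, hC⟩ := H.bounded_coef
  refine ⟨∑ _i : Fin H.size, |C|, by positivity, fun s ω => ?_⟩
  refine (Finset.abs_sum_le_sum_abs _ _).trans (Finset.sum_le_sum fun i _ => ?_)
  simp only [indicator]
  split_ifs
  · exact (hC i ω).trans (le_abs_self C)
  · simp

lemma measurable_integral (H : ElementaryIntegrand 𝓕) {X : ℝ≥0 → Ω → ℝ} (hX : Adapted 𝓕 X)
    (t : ℝ≥0) : Measurable (H.integral X t) := by
  unfold integral
  refine Finset.measurable_fun_sum _ fun i _ => ?_
  exact ((H.measurable_coef i).mono (𝓕.le _) le_rfl).mul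
    (((hX _).mono (𝓕.le _) le_rfl).sub ((hX _).mono (𝓕.le _) le_rfl))

/-- All end points of the intervals of an elementary integrand. -/
noncomputable def grid (H : ElementaryIntegrand 𝓕) : Finset ℝ≥0 :=
  Finset.univ.image H.left ∪ Finset.univ.image H.right

lemma left_mem_grid (H : ElementaryIntegrand 𝓕) (i : Fin H.size) : H.left i ∈ H.grid := by
  simp [grid]

lemma right_mem_grid (H : ElementaryIntegrand 𝓕) (i : Fin H.size) : H.right i ∈ H.grid := by
  simp [grid]

/-- The grid point before `p`. -/
noncomputable def prev (G : Finset ℝ≥0) (p : ℝ≥0) : ℝ≥0 := (G.filter (· < p)).sup id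

lemma prev_le (G : Finset ℝ≥0) (p : ℝ≥0) : prev G p ≤ p :=
  Finset.sup_le fun _ hq => (Finset.mem_filter.1 hq).2.le

lemma le_prev {G : Finset ℝ≥0} {p q : ℝ≥0} (hq : q ∈ G) (h : q < p) : q ≤ prev G p :=
  Finset.le_sup (f := id) (Finset.mem_filter.2 ⟨hq, h⟩)

lemma prev_lt {G : Finset ℝ≥0} {p s : ℝ≥0} (hs : 0 < s) (h : ∀ q ∈ G, q < p → q < s) :
    prev G p < s := by
  refine (Finset.sup_lt_iff (by simpa using hs)).2 fun q hq => ?_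
  exact h q (Finset.mem_filter.1 hq).1 (Finset.mem_filter.1 hq).2

lemma eval_eq_of_mem_Ioc_prev {H : ElementaryIntegrand 𝓕} {G : Finset ℝ≥0} (hG : H.grid ⊆ G)
    {p s : ℝ≥0} (hs : s ∈ Ioc (prev G p) p) (ω : Ω) : H.eval s ω = H.eval p ω := by
  refine Finset.sum_congr rfl fun i _ => ?_
  have h1 : H.left i < s ↔ H.left i < p :=
    ⟨fun h => h.trans_le hs.2, fun h => (le_prev (hG (H.left_mem_grid i)) h).trans_lt hs.1⟩
  have h2 : s ≤ H.right i ↔ p ≤ H.right i :=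
    ⟨fun h => by
      by_contra h'
      exact absurd (le_prev (hG (H.right_mem_grid i)) (not_le.1 h'))
        (not_le.2 (hs.1.trans_le h)), fun h => hs.2.trans h⟩
  simp only [indicator, mem_Ioc, h1, h2]

lemma measurable_eval_prev {H : ElementaryIntegrand 𝓕} {G : Finset ℝ≥0} (hG : H.grid ⊆ G)
    (p : ℝ≥0) : Measurable[𝓕 (prev G p)] (H.eval p) := by
  unfold eval
  refine Finset.measurable_fun_sum _ fun i _ => ?_
  by_cases h : H.left i < p
  · have := (H.measurable_coef i).mono (𝓕.mono (le_prev (hG (H.left_mem_grid i)) h)) le_rfl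
    by_cases h2 : p ≤ H.right i
    · simpa [indicator, h, h2] using this
    · simp [indicator, h2]
  · simp [indicator, h]

lemma eval_eq_zero_of_grid {H : ElementaryIntegrand 𝓕} {s : ℝ≥0} (h : ∀ p ∈ H.grid, p < s)
    (ω : Ω) : H.eval s ω = 0 := by
  refine Finset.sum_eq_zero fun i _ => indicator_of_notMem (fun hs => ?_) _
  exact absurd (h _ (H.right_mem_grid i)) (not_lt.2 hs.2)

@[simp] lemma eval_at_zero (H : ElementaryIntegrand 𝓕) (ω : Ω) : H.eval 0 ω = 0 :=
  Finset.sum_eq_zero fun i _ => indicator_of_notMem (fun hs => by simpa using hs.1) _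

/-- On the common grid of `H` and `K` both are constant on each `(prev G p, p]` and known at its
left end, so any measurable function of them is again elementary. The condition `φ 0 0 = 0` covers
time `0` and times after the last grid point. Clamps, absolute values and maxima are the instances
used. -/
lemma exists_eval_eq_comp (H K : ElementaryIntegrand 𝓕) {φ : ℝ → ℝ → ℝ}
    (hφ : Measurable (Function.uncurry φ)) (h0 : φ 0 0 = 0)
    (hb : ∃ C : ℝ, ∀ s ω, |φ (H.eval s ω) (K.eval s ω)| ≤ C) :
    ∃ L : ElementaryIntegrand 𝓕, ∀ s ω, L.eval s ω = φ (H.eval s ω) (K.eval s ω) := by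
  classical
  set G : Finset ℝ≥0 := H.grid ∪ K.grid with hGdef
  have hH : H.grid ⊆ G := Finset.subset_union_left
  have hK : K.grid ⊆ G := Finset.subset_union_right
  have hmeas : ∀ p : G, Measurable[𝓕 (prev G p)] fun ω => φ (H.eval p ω) (K.eval p ω) :=
    fun p => hφ.comp (Measurable.prodMk (measurable_eval_prev hH p) (measurable_eval_prev hK p))
  refine ⟨ofFintype (ι := G) (fun p => prev G p) (fun p => p) (fun p => prev_le G p)
    (fun p ω => φ (H.eval p ω) (K.eval p ω)) hmeas (hb.imp fun C h p ω => h p ω), fun s ω => ?_⟩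
  · rw [eval_ofFintype]
    rcases eq_or_lt_of_le (zero_le (a := s)) with rfl | hs
    · simp [h0, indicator]
    by_cases hne : (G.filter (s ≤ ·)).Nonempty
    · obtain ⟨p, hp, hmin⟩ := Finset.exists_minimal hne
      obtain ⟨hpG, hsp⟩ := Finset.mem_filter.1 hp
      have hlt : ∀ q ∈ G, q < p → q < s := fun q hq hqp => by
        by_contra h
        exact absurd (hmin (Finset.mem_filter.2 ⟨hq, not_lt.1 h⟩) hqp.le) (not_le.2 hqp)
      have hmem : s ∈ Ioc (prev G p) p := ⟨prev_lt hs hlt, hsp⟩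
      rw [Finset.sum_eq_single ⟨p, hpG⟩]
      · rw [indicator_of_mem (by exact hmem), eval_eq_of_mem_Ioc_prev hH hmem,
          eval_eq_of_mem_Ioc_prev hK hmem]
      · rintro ⟨q, hq⟩ - hqp
        refine indicator_of_notMem (fun hs' => hqp ?_) _
        have hs'' : prev G q < s ∧ s ≤ q := hs'
        refine Subtype.ext (le_antisymm (not_lt.1 fun h => ?_) (not_lt.1 fun h => ?_))
        · exact absurd (le_prev hpG h) (not_le.2 (hs''.1.trans_le hsp))
        · exact absurd (hlt q hq h) (not_lt.2 hs''.2)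
      · simp
    · have hlt : ∀ p ∈ G, p < s := fun p hp => by
        by_contra h
        exact hne ⟨p, Finset.mem_filter.2 ⟨hp, not_lt.1 h⟩⟩
      rw [eval_eq_zero_of_grid fun p hp => hlt p (hH hp),
        eval_eq_zero_of_grid fun p hp => hlt p (hK hp), h0]
      refine Finset.sum_eq_zero fun p _ => indicator_of_notMem (fun hs' => ?_) _
      exact absurd (hlt p p.2) (not_lt.2 hs'.2)

end ElementaryIntegrand

end Elementary

/-! ### Size of elementary integrals in probability, and the sign argument. -/

section Mean

variable {Ω : Type*} [mΩ : MeasurableSpace Ω] {𝓕 : Filtration ℝ≥0 mΩ}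

namespace ElementaryIntegrand

/-- The size of the elementary integral over `(0, t]` in the metric of convergence in
probability. -/
noncomputable def mean (μ : Measure Ω) (X : ℝ≥0 → Ω → ℝ) (t : ℝ≥0) (H : ElementaryIntegrand 𝓕) : ℝ :=
  ∫ ω, min 1 |H.integral X t ω| ∂μ

variable {μ : Measure Ω} {X : ℝ≥0 → Ω → ℝ} {t : ℝ≥0}

lemma mean_nonneg (H : ElementaryIntegrand 𝓕) : 0 ≤ mean μ X t H :=
  integral_nonneg fun _ => le_min zero_le_one (abs_nonneg _)

lemma mean_eq_zero {H : ElementaryIntegrand 𝓕} (h : ∀ᵐ ω ∂μ, ∀ s ∈ Ioc 0 t, H.eval s ω = 0) :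
    mean μ X t H = 0 := by
  have : (fun ω => min 1 |H.integral X t ω|) =ᵐ[μ] fun _ => (0 : ℝ) := by
    filter_upwards [h] with ω hω
    simp [integral_eq_zero hω]
  rw [mean, integral_congr_ae this, integral_zero]

variable [IsProbabilityMeasure μ]

lemma integrable_of_abs_le {g : Ω → ℝ} (hg : Measurable g) (C : ℝ) (h : ∀ ω, |g ω| ≤ C) :
    Integrable g μ :=
  Integrable.of_bound hg.aestronglyMeasurable C (ae_of_all _ h)

lemma abs_min_one_abs_le (x : ℝ) : |min 1 (abs x)| ≤ 1 := by
  rw [abs_of_nonneg (le_min zero_le_one (abs_nonneg x))]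
  exact min_le_left _ _

lemma measurable_min_one_abs (hX : Adapted 𝓕 X) (H : ElementaryIntegrand 𝓕) :
    Measurable fun ω => min 1 |H.integral X t ω| :=
  measurable_const.min (H.measurable_integral hX t).abs

lemma integrable_min_one_abs (hX : Adapted 𝓕 X) (H : ElementaryIntegrand 𝓕) :
    Integrable (fun ω => min 1 |H.integral X t ω|) μ :=
  integrable_of_abs_le (measurable_min_one_abs hX H) 1 fun _ => abs_min_one_abs_le _

lemma lintegral_eq_ofReal_mean (hX : Adapted 𝓕 X) (H : ElementaryIntegrand 𝓕) :
    ∫⁻ ω, min 1 ‖H.integral X t ω‖ₑ ∂μ = ENNReal.ofReal (mean μ X t H) := by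
  rw [mean, ofReal_integral_eq_lintegral_ofReal (integrable_min_one_abs hX H)
    (ae_of_all _ fun _ => le_min zero_le_one (abs_nonneg _))]
  refine lintegral_congr fun ω => ?_
  rw [ENNReal.ofReal_min, ENNReal.ofReal_one, Real.enorm_eq_ofReal_abs]

lemma min_one_abs_le_add {x y z : ℝ} (h : |x| ≤ |y| + |z|) :
    min 1 |x| ≤ min 1 |y| + min 1 |z| := by
  have := abs_nonneg y
  have := abs_nonneg z
  rcases le_total 1 |y| with h1 | h1 <;> rcases le_total 1 |z| with h2 | h2 <;>
  rcases le_total 1 |x| with h3 | h3 <;> simp only [min_eq_left, min_eq_right, h1, h2, h3] <;>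
  linarith

lemma mean_le_add (hX : Adapted 𝓕 X) {H K L : ElementaryIntegrand 𝓕}
    (h : ∀ s ω, L.eval s ω = H.eval s ω + K.eval s ω) :
    mean μ X t L ≤ mean μ X t H + mean μ X t K := by
  rw [mean, mean, mean, ← integral_add (integrable_min_one_abs hX H) (integrable_min_one_abs hX K)]
  refine integral_mono (integrable_min_one_abs hX L)
    ((integrable_min_one_abs hX H).add (integrable_min_one_abs hX K)) fun ω => ?_
  refine min_one_abs_le_add ?_
  rw [integral_lin_of_eval (H := H) (K := K) (a := 1) (b := 1) (fun s _ => by simp [h s ω]) X]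
  simpa using abs_add_le (H.integral X t ω) (K.integral X t ω)

lemma tendsto_mean_of_ae {ι : Type*} {l : Filter ι} [l.IsCountablyGenerated] (hX : Adapted 𝓕 X)
    {f : ι → ElementaryIntegrand 𝓕}
    (h : ∀ᵐ ω ∂μ, Tendsto (fun k => (f k).integral X t ω) l (𝓝 0)) :
    Tendsto (fun k => mean μ X t (f k)) l (𝓝 0) := by
  have := tendsto_integral_filter_of_dominated_convergence (μ := μ) (l := l) (f := fun _ => (0 : ℝ))
    (F := fun k ω => min 1 |(f k).integral X t ω|) (fun _ => 1)
    (Eventually.of_forall fun k => (measurable_min_one_abs hX (f k)).aestronglyMeasurable)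
    (Eventually.of_forall fun k => ae_of_all _ fun ω => abs_min_one_abs_le _)
    (integrable_const 1) ?_
  · simpa [mean] using this
  · filter_upwards [h] with ω hω
    have := (tendsto_const_nhds (x := (1 : ℝ))).min hω.abs
    simpa using this

/-- Integrals of uniformly small elementary integrands are small in probability. -/
lemma exists_mean_le (hX : IsSemimartingale μ 𝓕 X) (t : ℝ≥0) {ε : ℝ} (hε : 0 < ε) :
    ∃ η : ℝ, 0 < η ∧ ∀ H : ElementaryIntegrand 𝓕, (∀ s ω, |H.eval s ω| ≤ η) → mean μ X t H ≤ ε := by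
  -- The good integrator property is sequential: a failure for every `η = 1 / (n + 1)` gives a
  -- sequence that tends uniformly to zero and has means above `ε`.
  by_contra! hcon
  choose H hH hmean using fun n : ℕ => hcon (1 / ((n : ℝ) + 1)) Nat.one_div_pos_of_nat
  have hconv := hX.good_integrator t H fun δ hδ => by
    filter_upwards [(tendsto_one_div_add_atTop_nhds_zero_nat (𝕜 := ℝ)).eventually_le_const hδ] with
      n hn s ω
    exact (hH n s ω).trans hn
  rw [tendstoInMeasure_iff_norm] at hconv
  have hsmall := (hconv (ε / 2) (by positivity)).eventually_lt_const
    (show (0 : ℝ≥0∞) < ENNReal.ofReal (ε / 2) by simpa using hε)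
  obtain ⟨n, hn⟩ := hsmall.exists
  refine absurd (hmean n) (not_lt.2 ?_)
  set S := {ω | ε / 2 ≤ ‖(H n).integral X t ω - 0‖}
  have hS : MeasurableSet S := by
    have := (H n).measurable_integral hX.adapted t
    exact measurableSet_le measurable_const (this.sub_const 0).norm
  have hle : ∀ ω, min 1 |(H n).integral X t ω| ≤ ε / 2 + S.indicator (fun _ => 1) ω := fun ω => by
    by_cases hω : ω ∈ S
    · rw [indicator_of_mem hω]
      exact (min_le_left _ _).trans (by linarith)
    · rw [indicator_of_notMem hω, add_zero]
      have : ‖(H n).integral X t ω - 0‖ < ε / 2 := not_le.1 hω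
      rw [sub_zero, Real.norm_eq_abs] at this
      exact (min_le_right _ _).trans this.le
  have hint : Integrable (fun ω => ε / 2 + S.indicator (fun _ => (1 : ℝ)) ω) μ :=
    (integrable_const _).add ((integrable_const _).indicator hS)
  refine (integral_mono (integrable_min_one_abs hX.adapted (H n)) hint hle).trans ?_
  rw [integral_add (integrable_const _) ((integrable_const _).indicator hS),
    integral_indicator_const _ hS]
  have : μ.real S ≤ ε / 2 := ENNReal.toReal_le_of_le_ofReal (by positivity) hn.le
  simp
  linarith

lemma one_sub_cos_le (x : ℝ) : 1 - Real.cos x ≤ 2 * min 1 |x| := by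
  rcases le_total 1 |x| with h | h
  · rw [min_eq_left h]
    linarith [Real.neg_one_le_cos x]
  · rw [min_eq_right h]
    have h1 := Real.one_sub_sq_div_two_le_cos (x := x)
    have h2 : x ^ 2 ≤ |x| := by
      rw [← sq_abs]
      nlinarith [abs_nonneg x]
    linarith [abs_nonneg x]

/-- Signs can be chosen such that the characteristic function of a signed sum is at most the
product of cosines. -/
lemma exists_signed_sum (hX : Adapted 𝓕 X) (f : ℕ → ElementaryIntegrand 𝓕) (c : ℝ) (N : ℕ) :
    ∀ S : ElementaryIntegrand 𝓕, ∃ Y : ElementaryIntegrand 𝓕,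
      (∀ s ω, |Y.eval s ω| ≤ |S.eval s ω| + ∑ j ∈ Finset.range N, |(f j).eval s ω|) ∧
      ∫ ω, Real.cos (c * Y.integral X t ω) ∂μ ≤
        ∫ ω, Real.cos (c * S.integral X t ω) *
          ∏ j ∈ Finset.range N, Real.cos (c * (f j).integral X t ω) ∂μ := by
  -- The statement is for all `S`, because the induction step absorbs the signed last term into `S`.
  induction N with
  | zero => exact fun S => ⟨S, by simp, by simp⟩
  | succ N ih =>
    intro S
    let S' (a : ℝ) := lin 1 S a (f N)
    let Q (ω : Ω) : ℝ := ∏ j ∈ Finset.range N, Real.cos (c * (f j).integral X t ω)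
    have hcos : ∀ H : ElementaryIntegrand 𝓕, Measurable fun ω => Real.cos (c * H.integral X t ω) :=
      fun H => Real.measurable_cos.comp ((H.measurable_integral hX t).const_mul c)
    have hQ : Measurable Q := Finset.measurable_fun_prod _ fun j _ => hcos (f j)
    have hQ1 : ∀ ω, |Q ω| ≤ 1 := fun ω => by
      rw [Finset.abs_prod]
      exact Finset.prod_le_one (fun _ _ => abs_nonneg _) fun _ _ => Real.abs_cos_le_one _
    have hint : ∀ H : ElementaryIntegrand 𝓕,
        Integrable (fun ω => Real.cos (c * H.integral X t ω) * Q ω) μ := fun H =>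
      integrable_of_abs_le ((hcos H).mul hQ) 1 fun ω => by
        rw [abs_mul]
        exact mul_le_one₀ (Real.abs_cos_le_one _) (abs_nonneg _) (hQ1 ω)
    -- From `cos (u + v) + cos (u - v) = 2 cos u cos v`: the two signs average to the product, so
    -- one of them does no worse.
    have havg : ∫ ω, Real.cos (c * (S' 1).integral X t ω) * Q ω ∂μ +
        ∫ ω, Real.cos (c * (S' (-1)).integral X t ω) * Q ω ∂μ =
        2 * ∫ ω, Real.cos (c * S.integral X t ω) *
          ∏ j ∈ Finset.range (N + 1), Real.cos (c * (f j).integral X t ω) ∂μ := by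
      rw [← integral_add (hint _) (hint _), ← integral_const_mul]
      refine integral_congr_ae (ae_of_all _ fun ω => ?_)
      simp only [S', integral_lin, Finset.prod_range_succ, Q]
      rw [show c * (1 * S.integral X t ω + 1 * (f N).integral X t ω)
          = c * S.integral X t ω + c * (f N).integral X t ω by ring,
        show c * (1 * S.integral X t ω + -1 * (f N).integral X t ω)
          = c * S.integral X t ω - c * (f N).integral X t ω by ring, Real.cos_add, Real.cos_sub]
      ring
    have hsign : ∃ a : ℝ, |a| = 1 ∧ ∫ ω, Real.cos (c * (S' a).integral X t ω) * Q ω ∂μ ≤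
        ∫ ω, Real.cos (c * S.integral X t ω) *
          ∏ j ∈ Finset.range (N + 1), Real.cos (c * (f j).integral X t ω) ∂μ := by
      by_contra! h
      have h1 := h 1 (by simp)
      have h2 := h (-1) (by simp)
      linarith
    obtain ⟨a, ha, hle⟩ := hsign
    obtain ⟨Y, hY, hYle⟩ := ih (S' a)
    refine ⟨Y, fun s ω => (hY s ω).trans ?_, hYle.trans hle⟩
    have : |(S' a).eval s ω| ≤ |S.eval s ω| + |(f N).eval s ω| := by
      simp only [S', eval_lin, one_mul]
      refine (abs_add_le _ _).trans ?_
      rw [abs_mul, ha, one_mul]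
    rw [Finset.sum_range_succ]
    linarith

/-- All signed sums of the `f j` are bounded by `C`, so at a small frequency `c` the expected cosine
of their integrals is near `1`. For suitable signs it is at most the expectation of `∏ cos (c ξ j)`,
where `ξ j` is the integral of `f j`. So the infinite product of `|cos (c ξ j)|` is near `1` in
mean. Where it is positive its factors tend to `1`, which forces `ξ j → 0` along the indices with
`|c ξ j| ≤ 1`; the other indices are controlled by the mean of `c ξ j`. -/
lemma mean_tendsto_zero_of_sum_abs_le (hX : IsSemimartingale μ 𝓕 X) (t : ℝ≥0)
    {f : ℕ → ElementaryIntegrand 𝓕} {C : ℝ} (hC : 0 < C)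
    (hf : ∀ N s ω, ∑ j ∈ Finset.range N, |(f j).eval s ω| ≤ C) :
    Tendsto (fun j => mean μ X t (f j)) atTop (𝓝 0) := by
  have hA := hX.adapted
  refine tendsto_order.2 ⟨fun a ha => Eventually.of_forall fun j => ha.trans_le (mean_nonneg _),
    fun ε hε => ?_⟩
  obtain ⟨η, hη, hηle⟩ := exists_mean_le hX t (show 0 < ε / 8 by positivity)
  -- Scaling by `c` turns the bound `C` into the bound `η` of `exists_mean_le`.
  set c : ℝ := η / C with hc
  have hcpos : 0 < c := div_pos hη hC
  have hscale : ∀ Y : ElementaryIntegrand 𝓕, (∀ s ω, |Y.eval s ω| ≤ C) →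
      ∫ ω, min 1 |c * Y.integral X t ω| ∂μ ≤ ε / 8 := fun Y hY => by
    have := hηle (lin c Y 0 Y) fun s ω => by
      simp only [eval_lin, zero_mul, add_zero, abs_mul, abs_of_pos hcpos]
      calc c * |Y.eval s ω| ≤ c * C := mul_le_mul_of_nonneg_left (hY s ω) hcpos.le
        _ = η := by rw [hc]; field_simp
    simpa [mean] using this
  let ξ (j : ℕ) (ω : Ω) : ℝ := (f j).integral X t ω
  have hξ : ∀ j, Measurable (ξ j) := fun j => (f j).measurable_integral hA t
  let a (j : ℕ) (ω : Ω) : ℝ := |Real.cos (c * ξ j ω)|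
  have ha0 : ∀ j ω, 0 ≤ a j ω := fun j ω => abs_nonneg _
  have ha1 : ∀ j ω, a j ω ≤ 1 := fun j ω => Real.abs_cos_le_one _
  have ha : ∀ j, Measurable (a j) := fun j =>
    (Real.measurable_cos.comp ((hξ j).const_mul c)).abs
  let q (N : ℕ) (ω : Ω) : ℝ := ∏ j ∈ Finset.range N, a j ω
  have hq : ∀ N, Measurable (q N) := fun N => Finset.measurable_fun_prod _ fun j _ => ha j
  have hq0 : ∀ N ω, 0 ≤ q N ω := fun N ω => Finset.prod_nonneg fun j _ => ha0 j ω
  have hq1 : ∀ N ω, q N ω ≤ 1 := fun N ω =>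
    Finset.prod_le_one (fun j _ => ha0 j ω) fun j _ => ha1 j ω
  have hanti : ∀ ω, Antitone fun N => q N ω := fun ω => antitone_nat_of_succ_le fun N => by
    simp only [q, Finset.prod_range_succ]
    exact mul_le_of_le_one_right (hq0 N ω) (ha1 N ω)
  -- The infinite product of the `a j`, which exists since the partial products decrease.
  let p (ω : Ω) : ℝ := ⨅ N, q N ω
  have hbdd : ∀ ω, BddBelow (range fun N => q N ω) := fun ω => ⟨0, by
    rintro _ ⟨N, rfl⟩
    exact hq0 N ω⟩
  have hlim : ∀ ω, Tendsto (fun N => q N ω) atTop (𝓝 (p ω)) := fun ω =>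
    tendsto_atTop_ciInf (hanti ω) (hbdd ω)
  have hp0 : ∀ ω, 0 ≤ p ω := fun ω => le_ciInf fun N => hq0 N ω
  have hp1 : ∀ ω, p ω ≤ 1 := fun ω => (ciInf_le (hbdd ω) 0).trans (hq1 0 ω)
  have hp : Measurable p := measurable_of_tendsto_metrizable hq (tendsto_pi_nhds.2 hlim)
  have hpint : Integrable p μ := integrable_of_abs_le hp 1 fun ω => by
    rw [abs_of_nonneg (hp0 ω)]; exact hp1 ω
  have hqint : ∀ N, Integrable (q N) μ := fun N => integrable_of_abs_le (hq N) 1 fun ω => by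
    rw [abs_of_nonneg (hq0 N ω)]; exact hq1 N ω
  have hqlow : ∀ N, 1 - ε / 4 ≤ ∫ ω, q N ω ∂μ := fun N => by
    obtain ⟨Y, hY, hYle⟩ := exists_signed_sum (μ := μ) (t := t) hA f c N (zero 𝓕)
    have hYC : ∀ s ω, |Y.eval s ω| ≤ C := fun s ω => by
      simpa using (hY s ω).trans (by simpa using hf N s ω)
    have hYm := (Y.measurable_integral hA t).const_mul c
    have hcosint : Integrable (fun ω => Real.cos (c * Y.integral X t ω)) μ :=
      integrable_of_abs_le (Real.measurable_cos.comp hYm) 1 fun ω => Real.abs_cos_le_one _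
    have h1 : ∫ ω, (1 - Real.cos (c * Y.integral X t ω)) ∂μ
        ≤ ∫ ω, 2 * min 1 |c * Y.integral X t ω| ∂μ := by
      refine integral_mono ((integrable_const 1).sub hcosint)
        (Integrable.const_mul (integrable_of_abs_le (measurable_const.min hYm.abs) 1
          fun _ => abs_min_one_abs_le _) 2) fun ω => one_sub_cos_le _
    rw [integral_sub (integrable_const 1) hcosint, integral_const_mul] at h1
    have h2 := hscale Y hYC
    have h3 : ∫ ω, Real.cos (c * (zero 𝓕).integral X t ω) *
        ∏ j ∈ Finset.range N, Real.cos (c * (f j).integral X t ω) ∂μ ≤ ∫ ω, q N ω ∂μ := by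
      have hm : Measurable fun ω => Real.cos (c * (zero 𝓕).integral X t ω) *
          ∏ j ∈ Finset.range N, Real.cos (c * (f j).integral X t ω) :=
        (Real.measurable_cos.comp (((zero 𝓕).measurable_integral hA t).const_mul c)).mul
          (Finset.measurable_fun_prod _ fun j _ => Real.measurable_cos.comp ((hξ j).const_mul c))
      have hle : ∀ ω, |Real.cos (c * (zero 𝓕).integral X t ω) *
          ∏ j ∈ Finset.range N, Real.cos (c * (f j).integral X t ω)| ≤ q N ω := fun ω => by
        rw [abs_mul, Finset.abs_prod]
        exact mul_le_of_le_one_left (hq0 N ω) (Real.abs_cos_le_one _)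
      exact integral_mono (integrable_of_abs_le hm 1 fun ω => (hle ω).trans (hq1 N ω)) (hqint N)
        fun ω => (le_abs_self _).trans (hle ω)
    simp only [integral_const, probReal_univ, smul_eq_mul, mul_one] at h1
    linarith
  have hplow : 1 - ε / 4 ≤ ∫ ω, p ω ∂μ := by
    have : Tendsto (fun N => ∫ ω, q N ω ∂μ) atTop (𝓝 (∫ ω, p ω ∂μ)) :=
      tendsto_integral_of_dominated_convergence (fun _ => 1)
        (fun N => (hq N).aestronglyMeasurable) (integrable_const 1)
        (fun N => ae_of_all _ fun ω => by
          rw [Real.norm_eq_abs, abs_of_nonneg (hq0 N ω)]; exact hq1 N ω)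
        (ae_of_all _ hlim)
    exact ge_of_tendsto' this hqlow
  -- Each factor is the ratio of consecutive partial products, which converge to the same nonzero
  -- limit.
  have ha_lim : ∀ ω, 0 < p ω → Tendsto (fun j => a j ω) atTop (𝓝 1) := fun ω hω => by
    have h1 := ((tendsto_add_atTop_iff_nat 1).2 (hlim ω)).div (hlim ω) hω.ne'
    rw [div_self hω.ne'] at h1
    refine h1.congr fun j => ?_
    have : q j ω ≠ 0 := ne_of_gt (hω.trans_le (ciInf_le (hbdd ω) j))
    simp only [Pi.div_apply]
    rw [show q (j + 1) ω = q j ω * a j ω from Finset.prod_range_succ _ _, mul_div_cancel_left₀ _ this]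
  let S (j : ℕ) : Set Ω := {ω | 0 < p ω ∧ |c * ξ j ω| ≤ 1}
  have hS : ∀ j, MeasurableSet (S j) := fun j =>
    (measurableSet_lt measurable_const hp).inter
      (measurableSet_le ((hξ j).const_mul c).abs measurable_const)
  let g (j : ℕ) (ω : Ω) : ℝ := (S j).indicator (fun ω => min 1 |ξ j ω|) ω
  have hgm : ∀ j, Measurable (g j) := fun j => (measurable_const.min (hξ j).abs).indicator (hS j)
  have hg0 : ∀ j ω, 0 ≤ g j ω := fun j ω =>
    indicator_nonneg (fun _ _ => le_min zero_le_one (abs_nonneg _)) ω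
  have hg1 : ∀ j ω, |g j ω| ≤ 1 := fun j ω => by
    rw [abs_of_nonneg (hg0 j ω)]
    exact indicator_le' (fun _ _ => min_le_left _ _) (fun _ _ => zero_le_one) ω
  have hglim : ∀ ω, Tendsto (fun j => g j ω) atTop (𝓝 0) := fun ω => by
    by_cases hω : 0 < p ω
    -- The inequality `cos x ≤ 1 - 2 x ^ 2 / π ^ 2`, solved for the integral.
    · have hb : ∀ j, g j ω ≤ √((1 - a j ω) * (Real.pi ^ 2 / 2) / c ^ 2) := fun j => by
        by_cases hj : ω ∈ S j
        · have hx : |c * ξ j ω| ≤ 1 := hj.2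
          have hgj : g j ω = min 1 |ξ j ω| := indicator_of_mem hj _
          rw [hgj]
          refine (min_le_right _ _).trans (Real.le_sqrt_of_sq_le ?_)
          have h1 := Real.cos_le_one_sub_mul_cos_sq (x := c * ξ j ω)
            (hx.trans (by linarith [Real.pi_gt_three]))
          have h2 : 0 ≤ Real.cos (c * ξ j ω) := Real.cos_nonneg_of_neg_pi_div_two_le_of_le
            (by linarith [(abs_le.1 hx).1, Real.pi_gt_three])
            (by linarith [(abs_le.1 hx).2, Real.pi_gt_three])
          have h3 : a j ω = Real.cos (c * ξ j ω) := abs_of_nonneg h2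
          rw [h3, sq_abs, le_div_iff₀ (by positivity)]
          have hpi : 0 < Real.pi ^ 2 := by positivity
          calc ξ j ω ^ 2 * c ^ 2 = (2 / Real.pi ^ 2 * (c * ξ j ω) ^ 2) * (Real.pi ^ 2 / 2) := by
                field_simp
            _ ≤ _ := mul_le_mul_of_nonneg_right (by linarith) (by positivity)
        · have hgj : g j ω = 0 := indicator_of_notMem hj _
          rw [hgj]
          exact Real.sqrt_nonneg _
      have hs : Tendsto (fun j => √((1 - a j ω) * (Real.pi ^ 2 / 2) / c ^ 2)) atTop (𝓝 0) := by
        have := (((ha_lim ω hω).const_sub 1).mul_const (Real.pi ^ 2 / 2)).div_const (c ^ 2)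
        simpa using this.sqrt
      exact squeeze_zero (fun j => hg0 j ω) hb hs
    · have : (fun j => g j ω) = fun _ => 0 := funext fun j => indicator_of_notMem (fun h => hω h.1) _
      rw [this]
      exact tendsto_const_nhds
  have hgint : Tendsto (fun j => ∫ ω, g j ω ∂μ) atTop (𝓝 0) := by
    have := tendsto_integral_of_dominated_convergence (μ := μ) (F := g) (f := fun _ => 0)
      (fun _ => 1) (fun j => (hgm j).aestronglyMeasurable) (integrable_const 1)
      (fun j => ae_of_all _ (hg1 j)) (ae_of_all _ hglim)
    simpa using this
  filter_upwards [hgint.eventually_lt_const (show 0 < ε / 4 by positivity)] with j hj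
  -- Off `S j` either `p` vanishes or `|c ξ j| > 1`, and the first or the second summand is then at
  -- least `1`. The three expectations are at most `ε / 4`, `ε / 8` and `ε / 4`.
  have hpt : ∀ ω, min 1 |ξ j ω| ≤ (1 - p ω) + min 1 |c * ξ j ω| + g j ω := fun ω => by
    have h1 : 0 ≤ min 1 |c * ξ j ω| := le_min zero_le_one (abs_nonneg _)
    have h2 := hg0 j ω
    have h3 := hp1 ω
    by_cases hω : ω ∈ S j
    · have : g j ω = min 1 |ξ j ω| := indicator_of_mem hω _
      linarith
    · have h4 : min 1 |ξ j ω| ≤ 1 := min_le_left _ _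
      by_cases h5 : 0 < p ω
      · have : 1 < |c * ξ j ω| := not_le.1 fun h => hω ⟨h5, h⟩
        rw [min_eq_left this.le]
        linarith
      · have := le_antisymm (not_lt.1 h5) (hp0 ω)
        linarith
  have hCj : ∀ s ω, |(f j).eval s ω| ≤ C := fun s ω =>
    (Finset.single_le_sum (f := fun j => |(f j).eval s ω|) (fun _ _ => abs_nonneg _)
      (Finset.self_mem_range_succ j)).trans (hf (j + 1) s ω)
  have hci : Integrable (fun ω => min 1 |c * ξ j ω|) μ :=
    integrable_of_abs_le (measurable_const.min ((hξ j).const_mul c).abs) 1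
      fun _ => abs_min_one_abs_le _
  have hgi : Integrable (g j) μ := integrable_of_abs_le (hgm j) 1 (hg1 j)
  have h1p : Integrable (fun ω => 1 - p ω) μ := (integrable_const 1).sub hpint
  have hfin := integral_mono (integrable_min_one_abs (t := t) hA (f j)) ((h1p.add hci).add hgi) hpt
  have e1 : ∫ ω, ((fun ω => 1 - p ω) + (fun ω => min 1 |c * ξ j ω|) + g j) ω ∂μ
      = (1 - ∫ ω, p ω ∂μ) + ∫ ω, min 1 |c * ξ j ω| ∂μ + ∫ ω, g j ω ∂μ := by
    rw [integral_add' (h1p.add hci) hgi, integral_add' h1p hci,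
      integral_sub (integrable_const 1) hpint]
    simp
  have h8 := hscale (f j) hCj
  have : mean μ X t (f j) ≤ (1 - ∫ ω, p ω ∂μ) + ∫ ω, min 1 |c * ξ j ω| ∂μ + ∫ ω, g j ω ∂μ :=
    e1 ▸ hfin
  linarith

end ElementaryIntegrand

end Mean

/-! ### Subadditivity and continuity of the mean on elementary integrands. -/

section Continuity

variable {Ω : Type*} [mΩ : MeasurableSpace Ω] {𝓕 : Filtration ℝ≥0 mΩ}

namespace ElementaryIntegrand

/-- The elementary integrand restricted to `(a, b]`. -/
noncomputable def restrict (H : ElementaryIntegrand 𝓕) (a b : ℝ≥0) : ElementaryIntegrand 𝓕 where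
  size := H.size
  left i := max (H.left i) a
  right i := max (max (H.left i) a) (min (H.right i) b)
  left_le_right _ := le_max_left _ _
  coef := H.coef
  measurable_coef i := (H.measurable_coef i).mono (𝓕.mono (le_max_left _ _)) le_rfl
  bounded_coef := H.bounded_coef

lemma eval_restrict (H : ElementaryIntegrand 𝓕) (a b s : ℝ≥0) (ω : Ω) :
    (H.restrict a b).eval s ω = (Ioc a b).indicator (fun s => H.eval s ω) s := by
  have h : ∀ i, Ioc (max (H.left i) a) (max (max (H.left i) a) (min (H.right i) b))
      = Ioc a b ∩ Ioc (H.left i) (H.right i) := fun i => by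
    ext s
    simp only [mem_Ioc, mem_inter_iff, max_lt_iff, le_max_iff, le_min_iff]
    constructor
    · rintro ⟨⟨h1, h2⟩, (h3 | h3) | h3⟩
      · exact absurd h1 (not_lt.2 h3)
      · exact absurd h2 (not_lt.2 h3)
      · exact ⟨⟨h2, h3.2⟩, h1, h3.1⟩
    · rintro ⟨⟨h1, h2⟩, h3, h4⟩
      exact ⟨⟨h3, h1⟩, Or.inr ⟨h4, h2⟩⟩
  simp only [eval, restrict, h, ← indicator_indicator]
  by_cases hs : s ∈ Ioc a b
  · simp [indicator_of_mem hs]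
    rfl
  · simp [indicator_of_notMem hs]

/-- A real constant on `(a, b]`. -/
noncomputable def const (𝓕 : Filtration ℝ≥0 mΩ) (c : ℝ) (a b : ℝ≥0) : ElementaryIntegrand 𝓕 where
  size := 1
  left _ := a
  right _ := max a b
  left_le_right _ := le_max_left _ _
  coef _ _ := c
  measurable_coef _ := measurable_const
  bounded_coef := ⟨|c|, fun _ _ => le_rfl⟩

lemma eval_const (c : ℝ) (a b s : ℝ≥0) (ω : Ω) :
    (const 𝓕 c a b).eval s ω = (Ioc a b).indicator (fun _ => c) s := by
  have : Ioc a (max a b) = Ioc a b := by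
    ext s
    simp only [mem_Ioc, le_max_iff]
    exact ⟨fun h => ⟨h.1, h.2.resolve_left (not_le.2 h.1)⟩, fun h => ⟨h.1, Or.inr h.2⟩⟩
  change ∑ _i : Fin 1, (Ioc a (max a b)).indicator (fun _ => c) s = _
  simp [this]

/-- `clamp x y` is the point of `[-|y|, |y|]` closest to `x`. -/
noncomputable def clamp (x y : ℝ) : ℝ := max (-|y|) (min x |y|)

lemma abs_clamp_le (x y : ℝ) : |clamp x y| ≤ |y| := by
  rw [clamp, abs_le]
  exact ⟨le_max_left _ _, max_le (by linarith [abs_nonneg y]) (min_le_right _ _)⟩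

lemma abs_clamp_le' (x y : ℝ) : |clamp x y| ≤ |x| := by
  have := abs_nonneg y
  have := abs_nonneg x
  rw [clamp, abs_le]
  refine ⟨le_max_of_le_right (le_min (neg_abs_le x) (by linarith)),
    max_le (by linarith) ((min_le_left _ _).trans (le_abs_self x))⟩

lemma abs_sub_clamp (x y : ℝ) : |x - clamp x y| = max 0 (|x| - |y|) := by
  have := abs_nonneg y
  unfold clamp
  rcases le_total x |y| with h | h
  · rw [min_eq_left h]
    rcases le_total (-|y|) x with h' | h'
    · rw [max_eq_right h', sub_self, abs_zero, max_eq_left]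
      linarith [abs_le.2 ⟨h', h⟩]
    · rw [max_eq_left h', abs_of_nonpos (by linarith), abs_of_nonpos (show x ≤ 0 by linarith),
        max_eq_right (by linarith)]
      ring
  · rw [min_eq_right h, max_eq_right (by linarith), abs_of_nonneg (by linarith),
      abs_of_nonneg (show 0 ≤ x by linarith), max_eq_right (by linarith)]

lemma measurable_clamp : Measurable (Function.uncurry clamp) := by
  unfold clamp Function.uncurry
  fun_prop

lemma exists_eval_eq_clamp (H K : ElementaryIntegrand 𝓕) :
    ∃ L : ElementaryIntegrand 𝓕, ∀ s ω, L.eval s ω = clamp (H.eval s ω) (K.eval s ω) := by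
  obtain ⟨C, -, hC⟩ := H.exists_abs_eval_le
  exact exists_eval_eq_comp H K measurable_clamp (by simp [clamp])
    ⟨C, fun s ω => (abs_clamp_le' _ _).trans (hC s ω)⟩

lemma exists_eval_eq_sum {ι : Type*} (I : Finset ι) (u : ι → ElementaryIntegrand 𝓕) :
    ∃ L : ElementaryIntegrand 𝓕, ∀ s ω, L.eval s ω = ∑ i ∈ I, (u i).eval s ω := by
  classical
  induction I using Finset.induction_on with
  | empty => exact ⟨zero 𝓕, by simp⟩
  | insert a I ha ih =>
    obtain ⟨L, hL⟩ := ih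
    exact ⟨lin 1 (u a) 1 L, fun s ω => by simp [Finset.sum_insert ha, hL]⟩

variable {μ : Measure Ω} [IsProbabilityMeasure μ] {X : ℝ≥0 → Ω → ℝ}

/-- Subadditivity of the Daniell mean on elementary integrands. -/
lemma mean_le_sum {t : ℝ≥0} (hX : Adapted 𝓕 X) {ι : Type*} (I : Finset ι)
    (u : ι → ElementaryIntegrand 𝓕) (hu : ∀ i ∈ I, ∀ s ω, 0 ≤ (u i).eval s ω) (M : ι → ℝ)
    (hM : ∀ i ∈ I, ∀ H : ElementaryIntegrand 𝓕,
      (∀ s ω, |H.eval s ω| ≤ (u i).eval s ω) → mean μ X t H ≤ M i) :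
    ∀ H : ElementaryIntegrand 𝓕, (∀ s ω, |H.eval s ω| ≤ ∑ i ∈ I, (u i).eval s ω) →
      mean μ X t H ≤ ∑ i ∈ I, M i := by
  classical
  induction I using Finset.induction_on with
  | empty =>
    intro H hH
    rw [mean_eq_zero (ae_of_all _ fun ω s _ => ?_)]
    · simp
    · simpa using hH s ω
  | insert a I ha ih =>
    intro H hH
    have hua := hu a (Finset.mem_insert_self a I)
    -- Riesz decomposition: the clamp is bounded by `u a`, and the excess by the sum of the
    -- remaining terms.
    obtain ⟨L, hL⟩ := exists_eval_eq_clamp H (u a)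
    rw [Finset.sum_insert ha]
    refine (mean_le_add hX (H := L) (K := lin 1 H (-1) L) fun s ω => by simp).trans
      (add_le_add (hM a (Finset.mem_insert_self a I) L fun s ω => ?_)
        (ih (fun i hi => hu i (Finset.mem_insert_of_mem hi))
          (fun i hi => hM i (Finset.mem_insert_of_mem hi)) _ fun s ω => ?_))
    · rw [hL]
      exact (abs_clamp_le _ _).trans (abs_of_nonneg (hua s ω)).le
    · have h1 : (lin 1 H (-1) L).eval s ω = H.eval s ω - clamp (H.eval s ω) ((u a).eval s ω) := by
        simp [hL]; ring
      rw [h1, abs_sub_clamp, abs_of_nonneg (hua s ω)]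
      have h2 := hH s ω
      rw [Finset.sum_insert ha] at h2
      exact max_le (Finset.sum_nonneg fun i hi => hu i (Finset.mem_insert_of_mem hi) s ω)
        (by linarith)

/-- Right continuity of `X`, for one fixed integrand. Uniformity over bounded integrands is the
harder statement that follows. -/
lemma tendsto_mean_restrict (hX : IsSemimartingale μ 𝓕 X) (t : ℝ≥0) (H : ElementaryIntegrand 𝓕)
    (a : ℝ≥0) : Tendsto (fun b => mean μ X t (H.restrict a b)) (𝓝[>] a) (𝓝 0) := by
  refine tendsto_mean_of_ae hX.adapted ?_
  filter_upwards [hX.right_continuous] with ω hω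
  have hterm : ∀ i : Fin H.size, Tendsto (fun b => H.coef i ω *
      (X (min (max (max (H.left i) a) (min (H.right i) b)) t) ω - X (min (max (H.left i) a) t) ω))
      (𝓝[>] a) (𝓝 0) := fun i => by
    have hcont : Continuous fun b => min (max (max (H.left i) a) (min (H.right i) b)) t := by
      fun_prop
    have h1 := hcont.tendsto a
    have h2 : max (max (H.left i) a) (min (H.right i) a) = max (H.left i) a :=
      max_eq_left ((min_le_right _ _).trans (le_max_right _ _))
    rw [h2] at h1
    have h3 := (hω (min (max (H.left i) a) t)).tendsto.comp
      (tendsto_nhdsWithin_iff.2 ⟨h1.mono_left (nhdsWithin_le_nhds (s := Ioi a)),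
        Eventually.of_forall fun b => min_le_min_right t (le_max_left _ _)⟩)
    simpa using (h3.sub_const (X (min (max (H.left i) a) t) ω)).const_mul (H.coef i ω)
  have hsum := tendsto_finsetSum Finset.univ fun i (_ : i ∈ Finset.univ) => hterm i
  rw [Finset.sum_const_zero] at hsum
  exact hsum

/-- The Daniell mean of `(a, b]` is small for `b` close to `a`. -/
lemma exists_mean_le_of_abs_le_Ioc (hX : IsSemimartingale μ 𝓕 X) (t a : ℝ≥0) {C ε : ℝ}
    (hC : 0 < C) (hε : 0 < ε) :
    ∃ b, a < b ∧ ∀ H : ElementaryIntegrand 𝓕,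
      (∀ s ω, |H.eval s ω| ≤ (Ioc a b).indicator (fun _ => C) s) → mean μ X t H ≤ ε := by
  by_contra! hcon
  -- Gliding hump: from an integrand on `(a, b]` with mean above `ε`, cut off a piece `(a, b']` of
  -- mean below `ε / 2`. The rest lives on `(b', b]`; iteration gives integrands on disjoint
  -- intervals, each of mean at least `ε / 2`, although their absolute values sum to at most `C`.
  have step : ∀ b : Ioi a, ∃ b' : Ioi a, ∃ G : ElementaryIntegrand 𝓕,
      (∀ s ω, |G.eval s ω| ≤ (Ioc (b' : ℝ≥0) b).indicator (fun _ => C) s) ∧ b' ≤ b ∧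
        ε / 2 ≤ mean μ X t G := by
    rintro ⟨b, hb⟩
    obtain ⟨H, hH, hHε⟩ := hcon b hb
    have hev := (tendsto_mean_restrict hX t H a).eventually_lt_const
      (show 0 < ε / 2 by positivity)
    obtain ⟨b', hb'1, hb'2, hb'3⟩ :=
      (hev.and ((Ioc_mem_nhdsGT hb : ∀ᶠ x in 𝓝[>] a, x ∈ Ioc a b))).exists
    refine ⟨⟨b', hb'2⟩, lin 1 H (-1) (H.restrict a b'), fun s ω => ?_, hb'3, ?_⟩
    · have := hH s ω
      simp only [eval_lin, eval_restrict, indicator, mem_Ioc] at this ⊢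
      by_cases h1 : a < s
      · by_cases h2 : s ≤ b'
        · simp [h1, h2, not_lt.2 h2]
        · simpa [h1, h2, not_le.1 h2] using this
      · have h3 : ¬ b' < s := fun h => h1 ((show a < b' from hb'2).trans h)
        simpa [h1, h3] using this
    · have := mean_le_add (μ := μ) (t := t) hX.adapted (L := H) (H := H.restrict a b')
        (K := lin 1 H (-1) (H.restrict a b')) fun s ω => by simp
      linarith
  choose next G hG hle hmean using step
  let d : ℕ → Ioi a := fun n => next^[n] ⟨a + 1, lt_add_of_pos_right a one_pos⟩
  have hd : ∀ n, d (n + 1) = next (d n) := fun n => Function.iterate_succ_apply' _ _ _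
  have hanti : Antitone d := antitone_nat_of_succ_le fun n => by
    rw [hd]; exact hle _
  have hsum : ∀ N s ω, ∑ j ∈ Finset.range N, |(G (d j)).eval s ω|
      ≤ (Ioc (d N : ℝ≥0) (d 0)).indicator (fun _ => C) s := by
    intro N s ω
    induction N with
    | zero => simp
    | succ N ih =>
      rw [Finset.sum_range_succ]
      have h1 := hG (d N) s ω
      rw [← hd] at h1
      refine (add_le_add ih h1).trans ?_
      have h3 : (d N : ℝ≥0) ≤ d 0 := hanti (Nat.zero_le N)
      have h4 : (d (N + 1) : ℝ≥0) ≤ d N := hanti (Nat.le_succ N)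
      rw [← Ioc_union_Ioc_eq_Ioc h4 h3, indicator_union_of_disjoint, add_comm]
      exact disjoint_left.2 fun x hx hx' => absurd hx.2 (not_le.2 hx'.1)
  have hlim := mean_tendsto_zero_of_sum_abs_le (μ := μ) hX t (f := fun j => G (d j)) hC
    fun N s ω => (hsum N s ω).trans (indicator_le' (fun _ _ => le_rfl) (fun _ _ => hC.le) s)
  obtain ⟨j, hj⟩ := (hlim.eventually_lt_const (show 0 < ε / 2 by positivity)).exists
  exact absurd (hmean (d j)) (not_le.2 hj)

/-- Elementary paths are left-continuous, and can jump only immediately after a grid point. -/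
lemma eventually_eval_eq (H : ElementaryIntegrand 𝓕) (p : ℝ≥0) (ω : Ω) :
    ∀ᶠ s in 𝓝 p, H.eval s ω = H.eval p ω ∨ (p ∈ H.grid ∧ p < s) := by
  by_cases hp : p ∈ H.grid
  · have h1 : ∀ i, ∀ᶠ s in 𝓝 p, s ≤ p → (Ioc (H.left i) (H.right i)).indicator
        (fun _ => H.coef i ω) s = (Ioc (H.left i) (H.right i)).indicator
        (fun _ => H.coef i ω) p := fun i => by
      have e1 : ∀ᶠ s in 𝓝 p, s ≤ p → (H.left i < s ↔ H.left i < p) := by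
        by_cases h : H.left i < p
        · filter_upwards [Ioi_mem_nhds h] with s hs _ using ⟨fun _ => h, fun _ => hs⟩
        · exact Eventually.of_forall fun s hs => ⟨fun h' => h'.trans_le hs, fun h' => absurd h' h⟩
      have e2 : ∀ᶠ s in 𝓝 p, s ≤ p → (s ≤ H.right i ↔ p ≤ H.right i) := by
        by_cases h : p ≤ H.right i
        · exact Eventually.of_forall fun s hs => ⟨fun _ => h, fun _ => hs.trans h⟩
        · filter_upwards [Ioi_mem_nhds (not_le.1 h)] with s hs _
          exact ⟨fun h' => absurd h' (not_le.2 hs), fun h' => absurd h' h⟩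
      filter_upwards [e1, e2] with s hs1 hs2 hs
      simp only [indicator, mem_Ioc, hs1 hs, hs2 hs]
    filter_upwards [eventually_all.2 h1] with s hs
    rcases le_or_gt s p with h | h
    · exact Or.inl (Finset.sum_congr rfl fun i _ => hs i h)
    · exact Or.inr ⟨hp, h⟩
  · have h1 : ∀ i, ∀ᶠ s in 𝓝 p, (Ioc (H.left i) (H.right i)).indicator
        (fun _ => H.coef i ω) s = (Ioc (H.left i) (H.right i)).indicator
        (fun _ => H.coef i ω) p := fun i => by
      have hl : H.left i ≠ p := fun h => hp (h ▸ H.left_mem_grid i)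
      have hr : H.right i ≠ p := fun h => hp (h ▸ H.right_mem_grid i)
      have e1 : ∀ᶠ s in 𝓝 p, (H.left i < s ↔ H.left i < p) := by
        rcases lt_or_gt_of_ne hl with h | h
        · filter_upwards [Ioi_mem_nhds h] with s hs using ⟨fun _ => h, fun _ => hs⟩
        · filter_upwards [Iio_mem_nhds h] with s hs
          exact ⟨fun h' => absurd h' (not_lt.2 (le_of_lt hs)), fun h' => absurd h' (not_lt.2 h.le)⟩
      have e2 : ∀ᶠ s in 𝓝 p, (s ≤ H.right i ↔ p ≤ H.right i) := by
        rcases lt_or_gt_of_ne hr with h | h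
        · filter_upwards [Ioi_mem_nhds h] with s hs
          exact ⟨fun h' => absurd h' (not_le.2 hs), fun h' => absurd h' (not_le.2 h)⟩
        · filter_upwards [Iio_mem_nhds h] with s hs using ⟨fun _ => h.le, fun _ => le_of_lt hs⟩
      filter_upwards [e1, e2] with s hs1 hs2
      simp only [indicator, mem_Ioc, hs1, hs2]
    filter_upwards [eventually_all.2 h1] with s hs
    exact Or.inl (Finset.sum_congr rfl fun i _ => hs i)

/-- The set where a path of an elementary integrand is large is closed once a right neighbourhood
of every grid point is removed. -/
lemma isClosed_le_abs_eval_diff (H : ElementaryIntegrand 𝓕) (ω : Ω) (η : ℝ) {b : ℝ≥0 → ℝ≥0}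
    (hb : ∀ a, a < b a) {G : Finset ℝ≥0} (hG : H.grid ⊆ G) :
    IsClosed ({s | η ≤ |H.eval s ω|} \ ⋃ a ∈ G, Ioo a (b a)) := by
  have hopen : IsOpen (⋃ a ∈ G, Ioo a (b a)) :=
    isOpen_biUnion fun _ _ => isOpen_Ioo
  rw [isClosed_iff_frequently]
  intro p hp
  have hpU : p ∉ ⋃ a ∈ G, Ioo a (b a) :=
    isClosed_iff_frequently.1 hopen.isClosed_compl p (hp.mono fun s hs => hs.2)
  refine ⟨?_, hpU⟩
  obtain ⟨s, ⟨hs1, hs2⟩, hs3, hs4⟩ :=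
    (hp.and_eventually ((H.eventually_eval_eq p ω).and (Iio_mem_nhds (hb p)))).exists
  -- A point `s` near `p` with another value lies in `(p, b p)` for a grid point `p`, and this
  -- interval was removed.
  rcases hs3 with h | ⟨h1, h2⟩
  · have : η ≤ |H.eval s ω| := hs1
    rwa [h] at this
  · exact (hs2 (mem_iUnion₂.2 ⟨p, hG h1, h2, hs4⟩)).elim

/-- Dominated convergence for sequences of elementary integrands with decreasing absolute
values. -/
lemma tendsto_mean_of_antitone_abs (hX : IsSemimartingale μ 𝓕 X) (t : ℝ≥0)
    {f : ℕ → ElementaryIntegrand 𝓕} (hf : ∀ s ω, Antitone fun k => |(f k).eval s ω|)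
    (hlim : ∀ᵐ ω ∂μ, ∀ s ∈ Ioc 0 t, Tendsto (fun k => (f k).eval s ω) atTop (𝓝 0)) :
    Tendsto (fun k => mean μ X t (f k)) atTop (𝓝 0) := by
  classical
  have hA := hX.adapted
  refine tendsto_order.2 ⟨fun a ha => Eventually.of_forall fun j => ha.trans_le (mean_nonneg _),
    fun ε hε => ?_⟩
  obtain ⟨C₀, hC₀, hfC₀⟩ := (f 0).exists_abs_eval_le
  set C := C₀ + 1
  have hC : 0 < C := by positivity
  have hfC : ∀ k s ω, |(f k).eval s ω| ≤ C := fun k s ω =>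
    (hf s ω (Nat.zero_le k)).trans ((hfC₀ s ω).trans (by simp [C]))
  let G (k : ℕ) : Finset ℝ≥0 := (Finset.range (k + 1)).biUnion fun j => (f j).grid
  have hGmono : Monotone G := fun k l hkl =>
    Finset.biUnion_subset_biUnion_of_subset_left _ (Finset.range_mono (by omega))
  have hgrid : ∀ k, (f k).grid ⊆ G k := fun k =>
    Finset.subset_biUnion_of_mem (fun j => (f j).grid) (Finset.self_mem_range_succ k)
  have hcount : (⋃ k, (G k : Set ℝ≥0)).Countable :=
    countable_iUnion fun k => (G k).countable_toSet
  -- Grid points do not depend on the path, so there are countably many and the cost of all removed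
  -- intervals can be made summable.
  obtain ⟨e, he, hesum⟩ := hcount.exists_pos_forall_sum_le (show 0 < ε / 4 by positivity)
  choose b hb hbmean using fun a => exists_mean_le_of_abs_le_Ioc (μ := μ) hX t a hC (he a)
  obtain ⟨η, hη, hηmean⟩ := exists_mean_le (μ := μ) hX t (show 0 < ε / 4 by positivity)
  let u (a : ℝ≥0) : ElementaryIntegrand 𝓕 := const 𝓕 C a (b a)
  have hu : ∀ a s ω, (u a).eval s ω = (Ioc a (b a)).indicator (fun _ => C) s := fun a s ω =>
    eval_const _ _ _ _ _
  have hu0 : ∀ a s ω, 0 ≤ (u a).eval s ω := fun a s ω => by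
    rw [hu]; exact indicator_nonneg (fun _ _ => hC.le) s
  choose V hV using fun k => exists_eval_eq_sum (G k) u
  choose g hg using fun k => exists_eval_eq_clamp (f k) (V k)
  -- Decomposition `f k = g k + h' k + r k`: `g k` lives on the intervals to the right of grid
  -- points, `h' k` is at most `η`, and `r k` is what exceeds both.
  let h (k : ℕ) : ElementaryIntegrand 𝓕 := lin 1 (f k) (-1) (g k)
  choose h' hh' using fun k => exists_eval_eq_clamp (h k) (const 𝓕 η 0 t)
  let r (k : ℕ) : ElementaryIntegrand 𝓕 := lin 1 (h k) (-1) (h' k)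
  have hV0 : ∀ k s ω, 0 ≤ (V k).eval s ω := fun k s ω => by
    rw [hV]; exact Finset.sum_nonneg fun a _ => hu0 a s ω
  have hgmean : ∀ k, mean μ X t (g k) ≤ ε / 4 := fun k => by
    refine (mean_le_sum hA (G k) u (fun a _ => hu0 a) e (fun a _ H hH => hbmean a H fun s ω => ?_)
      (g k) fun s ω => ?_).trans (hesum (G k) (subset_iUnion (fun k => (G k : Set ℝ≥0)) k))
    · rw [← hu a s ω]; exact hH s ω
    · rw [hg, ← hV]
      exact (abs_clamp_le _ _).trans (abs_of_nonneg (hV0 k s ω)).le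
  have hh'mean : ∀ k, mean μ X t (h' k) ≤ ε / 4 := fun k => hηmean _ fun s ω => by
    rw [hh']
    refine (abs_clamp_le _ _).trans ?_
    rw [eval_const, abs_of_nonneg (indicator_nonneg (fun _ _ => hη.le) s)]
    exact indicator_le' (fun _ _ => le_rfl) (fun _ _ => hη.le) s
  have hrmean : Tendsto (fun k => mean μ X t (r k)) atTop (𝓝 0) := by
    refine tendsto_mean_of_ae hA ?_
    filter_upwards [hlim] with ω hω
    -- Compact decreasing sets. A common point would have to be positive, as elementary integrands
    -- vanish at `0`, and would contradict pointwise convergence. So some `K k₀` is empty, and from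
    -- then on `r k` vanishes on this path.
    let K (k : ℕ) : Set ℝ≥0 := Icc 0 t ∩ ({s | η ≤ |(f k).eval s ω|} \ ⋃ a ∈ G k, Ioo a (b a))
    have hKc : ∀ k, IsClosed (K k) := fun k =>
      isClosed_Icc.inter (isClosed_le_abs_eval_diff (f k) ω η hb (hgrid k))
    have hKanti : ∀ k l, k ≤ l → K l ⊆ K k := fun k l hkl s hs =>
      ⟨hs.1, le_trans (show η ≤ |(f l).eval s ω| from hs.2.1) (hf s ω hkl), fun hs' => hs.2.2
        (biUnion_subset_biUnion_left (Finset.coe_subset.2 (hGmono hkl)) hs')⟩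
    have hempty : ∃ k, K k = ∅ := by
      by_contra! hne
      obtain ⟨s, hs⟩ := IsCompact.nonempty_iInter_of_sequence_nonempty_isCompact_isClosed K
        (fun k => hKanti k (k + 1) (Nat.le_succ k)) hne
        (isCompact_Icc.inter_right (isClosed_le_abs_eval_diff (f 0) ω η hb (hgrid 0))) hKc
      have hs : ∀ k, s ∈ K k := mem_iInter.1 hs
      have hspos : 0 < s := by
        rcases eq_or_lt_of_le (zero_le (a := s)) with h0 | h0
        · have : η ≤ |(f 0).eval s ω| := (hs 0).2.1
          rw [← h0, eval_at_zero, abs_zero] at this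
          exact absurd hη (not_lt.2 this)
        · exact h0
      have h1 := (hω s ⟨hspos, (hs 0).1.2⟩).abs
      rw [abs_zero] at h1
      exact absurd (ge_of_tendsto' h1 fun k => (hs k).2.1) (not_le.2 hη)
    obtain ⟨k₀, hk₀⟩ := hempty
    refine tendsto_const_nhds.congr' ?_
    filter_upwards [eventually_ge_atTop k₀] with k hk
    refine (integral_eq_zero (fun s hs => ?_) X).symm
    have hKk : s ∉ K k := fun h => by
      have := hKanti k₀ k hk h
      rw [hk₀] at this
      exact this
    have e1 : (h k).eval s ω = (f k).eval s ω - clamp ((f k).eval s ω) ((V k).eval s ω) := by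
      simp only [h, eval_lin, hg]; ring
    have e2 : (r k).eval s ω
        = (h k).eval s ω - clamp ((h k).eval s ω) ((const 𝓕 η 0 t).eval s ω) := by
      simp only [r, eval_lin, hh']; ring
    rw [← abs_eq_zero, e2, abs_sub_clamp, max_eq_left]
    rw [eval_const, indicator_of_mem hs, abs_of_pos hη, e1, abs_sub_clamp,
      abs_of_nonneg (hV0 k s ω), sub_nonpos]
    refine max_le hη.le ?_
    -- On a removed interval `V k ≥ C ≥ |f k|`, so the clamp leaves nothing; elsewhere `|f k| < η`
    -- because `s` is not in `K k`.
    by_cases hsU : s ∈ ⋃ a ∈ G k, Ioo a (b a)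
    · obtain ⟨a, ha, hsa⟩ := mem_iUnion₂.1 hsU
      have : C ≤ (V k).eval s ω := by
        rw [hV]
        refine le_trans ?_ (Finset.single_le_sum (fun a _ => hu0 a s ω) ha)
        rw [hu, indicator_of_mem (Ioo_subset_Ioc_self hsa)]
      linarith [hfC k s ω]
    · have : |(f k).eval s ω| < η := not_le.1 fun h' => hKk ⟨⟨zero_le, hs.2⟩, h', hsU⟩
      linarith [hV0 k s ω]
  filter_upwards [hrmean.eventually_lt_const (show 0 < ε / 4 by positivity)] with k hk
  have h1 := mean_le_add (μ := μ) (t := t) hA (L := f k) (H := g k) (K := h k)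
    fun s ω => by simp [h]
  have h2 := mean_le_add (μ := μ) (t := t) hA (L := h k) (H := h' k) (K := r k)
    fun s ω => by simp [r]
  linarith [hgmean k, hh'mean k]

end ElementaryIntegrand

end Continuity

/-! ### Integrals of processes that sum to zero. -/

section Uniqueness

variable {Ω : Type*} [mΩ : MeasurableSpace Ω] {𝓕 : Filtration ℝ≥0 mΩ} {μ : Measure Ω}

open ElementaryIntegrand

lemma tendstoInMeasure_add {f f' : ℕ → Ω → ℝ} {g g' : Ω → ℝ}
    (h : TendstoInMeasure μ f atTop g) (h' : TendstoInMeasure μ f' atTop g') :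
    TendstoInMeasure μ (fun n ω => f n ω + f' n ω) atTop fun ω => g ω + g' ω := by
  rw [tendstoInMeasure_iff_norm] at *
  intro ε hε
  have hsum := (h (ε / 2) (half_pos hε)).add (h' (ε / 2) (half_pos hε))
  rw [add_zero] at hsum
  refine tendsto_of_tendsto_of_tendsto_of_le_of_le tendsto_const_nhds hsum (fun _ => zero_le)
    fun n => (measure_mono fun ω hω => ?_).trans (measure_union_le _ _)
  by_contra hcon
  simp only [mem_union, mem_ofPred_eq, not_or, not_le, Real.norm_eq_abs] at hcon hω
  have := abs_add_le (f n ω - g ω) (f' n ω - g' ω)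
  rw [show f n ω - g ω + (f' n ω - g' ω) = f n ω + f' n ω - (g ω + g' ω) by ring] at this
  linarith [hcon.1, hcon.2]

lemma tendstoInMeasure_sum {ι : Type*} (s : Finset ι) {f : ι → ℕ → Ω → ℝ} {g : ι → Ω → ℝ}
    (h : ∀ i, TendstoInMeasure μ (f i) atTop (g i)) :
    TendstoInMeasure μ (fun n ω => ∑ i ∈ s, f i n ω) atTop fun ω => ∑ i ∈ s, g i ω := by
  classical
  induction s using Finset.induction_on with
  | empty =>
    intro ε hε
    simp [hε.not_ge]
  | insert a s ha ih =>
    simp only [Finset.sum_insert ha]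
    exact tendstoInMeasure_add (h a) ih

lemma hasStochIntegral_zero (𝓕 : Filtration ℝ≥0 mΩ) (X : ℝ≥0 → Ω → ℝ) (t : ℝ≥0) :
    HasStochIntegral μ 𝓕 X (fun _ _ => 0) t fun _ => 0 := by
  have hz : ∀ ω, (zero 𝓕).integral X t ω = 0 := fun ω =>
    integral_eq_zero (fun s _ => eval_zero s ω) X
  refine ⟨fun _ => zero 𝓕, ?_, ?_⟩
  · have : daniellMean μ 𝓕 X t (fun s ω => 0 - (zero 𝓕).eval s ω) = 0 := by
      refine le_antisymm ?_ zero_le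
      refine (iInf₂_le (fun _ => zero 𝓕) (ae_of_all _ fun ω s _ => by simp)).trans ?_
      refine iSup₂_le fun Y hY => ?_
      refine le_of_eq (lintegral_eq_zero_of_ae_eq_zero ?_)
      filter_upwards [hY] with ω hω
      rw [integral_eq_zero fun s hs => by simpa using hω s hs]
      simp
    simp only [this]
    exact tendsto_const_nhds
  · intro ε hε
    simp [hz, hε.not_ge]

variable [IsProbabilityMeasure μ] {X : ℝ≥0 → Ω → ℝ} {t : ℝ≥0}

lemma tendstoInMeasure_zero_of_mean (hX : Adapted 𝓕 X) {f : ℕ → ElementaryIntegrand 𝓕}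
    (h : Tendsto (fun n => mean μ X t (f n)) atTop (𝓝 0)) :
    TendstoInMeasure μ (fun n => (f n).integral X t) atTop fun _ => 0 := by
  rw [tendstoInMeasure_iff_norm]
  intro ε hε
  set δ := min 1 ε
  have hδ : 0 < δ := lt_min one_pos hε
  have hlim := ENNReal.tendsto_ofReal (h.div_const δ)
  rw [zero_div, ENNReal.ofReal_zero] at hlim
  refine tendsto_of_tendsto_of_tendsto_of_le_of_le tendsto_const_nhds hlim (fun _ => zero_le)
    fun n => ?_
  have hmark := mul_meas_ge_le_integral_of_nonneg (μ := μ)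
    (ae_of_all _ fun ω => le_min zero_le_one (abs_nonneg ((f n).integral X t ω)))
    (integrable_min_one_abs hX (f n)) δ
  have hsub : {ω | ε ≤ ‖(f n).integral X t ω - 0‖} ⊆ {ω | δ ≤ min 1 |(f n).integral X t ω|} :=
    fun ω hω => by
      simp only [mem_ofPred_eq, sub_zero, Real.norm_eq_abs] at hω ⊢
      exact min_le_min_left 1 hω
  refine (measure_mono hsub).trans ?_
  rw [← ofReal_measureReal]
  refine ENNReal.ofReal_le_ofReal ((le_div_iff₀ hδ).2 ?_)
  rw [mul_comm]
  exact hmark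

/-- The running maximum of the absolute values of elementary integrands is elementary. -/
lemma exists_eval_eq_partialSups (h : ℕ → ElementaryIntegrand 𝓕) :
    ∃ u : ℕ → ElementaryIntegrand 𝓕, ∀ k s ω,
      (u k).eval s ω = partialSups (fun j => |(h j).eval s ω|) k := by
  have key : ∀ k, ∃ u : ElementaryIntegrand 𝓕, ∀ s ω,
      u.eval s ω = partialSups (fun j => |(h j).eval s ω|) k := fun k => by
    induction k with
    | zero =>
      obtain ⟨C, -, hC⟩ := (h 0).exists_abs_eval_le
      obtain ⟨L, hL⟩ := exists_eval_eq_comp (h 0) (h 0) (φ := fun x _ => |x|)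
        (by unfold Function.uncurry; fun_prop) (by simp) ⟨C, fun s ω => by simpa using hC s ω⟩
      exact ⟨L, fun s ω => by simp [hL]⟩
    | succ k ih =>
      obtain ⟨u, hu⟩ := ih
      obtain ⟨C, -, hC⟩ := u.exists_abs_eval_le
      obtain ⟨D, -, hD⟩ := (h (k + 1)).exists_abs_eval_le
      obtain ⟨L, hL⟩ := exists_eval_eq_comp u (h (k + 1)) (φ := fun x y => max x |y|)
        (by unfold Function.uncurry; fun_prop) (by simp) ⟨max C D, fun s ω => by
          refine abs_max_le_max_abs_abs.trans (max_le_max (hC s ω) ?_)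
          rw [abs_abs]
          exact hD s ω⟩
      refine ⟨L, fun s ω => ?_⟩
      rw [hL, hu, partialSups_add_one]
  choose u hu using key
  exact ⟨u, hu⟩

lemma ofReal_partialSups_abs_le (a : ℕ → ℝ) (k : ℕ) :
    ENNReal.ofReal (partialSups (fun j => |a j|) k) ≤ ⨆ j, ‖a j‖ₑ := by
  induction k with
  | zero =>
    simp only [partialSups_zero, ← Real.enorm_eq_ofReal_abs]
    exact le_iSup (fun j => ‖a j‖ₑ) 0
  | succ k ih =>
    rw [partialSups_add_one]
    change ENNReal.ofReal (max _ _) ≤ _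
    rw [ENNReal.ofReal_max]
    refine max_le ih ?_
    rw [← Real.enorm_eq_ofReal_abs]
    exact le_iSup (fun j => ‖a j‖ₑ) (k + 1)

/-- The supremum may be infinite or not attained; it suffices that some `w k` exceeds `|z| - ε`. -/
lemma tendsto_sub_clamp_of_enorm_le {z : ℝ} {w : ℕ → ℝ} (hw : Monotone w) (hw0 : ∀ k, 0 ≤ w k)
    (h : ‖z‖ₑ ≤ ⨆ k, ENNReal.ofReal (w k)) :
    Tendsto (fun k => z - clamp z (w k)) atTop (𝓝 0) := by
  rw [tendsto_zero_iff_abs_tendsto_zero]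
  simp only [Function.comp_def, abs_sub_clamp, abs_of_nonneg (hw0 _)]
  refine tendsto_order.2 ⟨fun a ha => Eventually.of_forall fun k => ha.trans_le (le_max_left _ _),
    fun ε hε => ?_⟩
  have hex : ∃ k, |z| - ε < w k := by
    by_contra! hcon
    rcases le_or_gt (|z|) 0 with hz | hz
    · linarith [hcon 0, hw0 0]
    · have h1 : (⨆ k, ENNReal.ofReal (w k)) ≤ ENNReal.ofReal (|z| - ε) :=
        iSup_le fun k => ENNReal.ofReal_le_ofReal (hcon k)
      have h2 := h.trans h1
      rw [Real.enorm_eq_ofReal_abs] at h2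
      exact absurd h2 (not_le.2 ((ENNReal.ofReal_lt_ofReal_iff hz).2 (by linarith)))
  obtain ⟨k₀, hk₀⟩ := hex
  filter_upwards [eventually_ge_atTop k₀] with k hk
  exact max_lt hε (by linarith [hw hk])

lemma exists_dominatedOn_of_daniellMean_lt (hX : Adapted 𝓕 X) {F : ℝ≥0 → Ω → ℝ} {ε : ℝ}
    (h : daniellMean μ 𝓕 X t F < ENNReal.ofReal ε) :
    ∃ u : ℕ → ElementaryIntegrand 𝓕, DominatedOn μ t F u ∧
      ∀ Y : ElementaryIntegrand 𝓕, DominatedOn μ t Y.eval u → mean μ X t Y ≤ ε := by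
  obtain ⟨u, hu⟩ := iInf_lt_iff.1 h
  obtain ⟨hdom, hlt⟩ := iInf_lt_iff.1 hu
  refine ⟨u, hdom, fun Y hY => ?_⟩
  have h1 := (le_iSup₂ (f := fun (Y : ElementaryIntegrand 𝓕) (_ : DominatedOn μ t Y.eval u) =>
    ∫⁻ ω, min 1 ‖Y.integral X t ω‖ₑ ∂μ) Y hY).trans_lt hlt
  rw [lintegral_eq_ofReal_mean hX] at h1
  exact ((ENNReal.ofReal_lt_ofReal_iff').1 h1).1.le

/-- An elementary integrand that is dominated by the sum of finitely many processes with small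
Daniell means has a small integral. -/
lemma mean_le_of_dominated_sum (hX : IsSemimartingale μ 𝓕 X) {ι : Type*} [Fintype ι]
    {F : ι → ℝ≥0 → Ω → ℝ} {ε : ℝ}
    (hF : ∀ i, daniellMean μ 𝓕 X t (F i) < ENNReal.ofReal ε) {Z : ElementaryIntegrand 𝓕}
    (hZ : ∀ᵐ ω ∂μ, ∀ s ∈ Ioc 0 t, |Z.eval s ω| ≤ ∑ i, |F i s ω|) :
    mean μ X t Z ≤ ∑ _i : ι, ε := by
  have hA := hX.adapted
  choose h hdom hmean using fun i => exists_dominatedOn_of_daniellMean_lt hA (hF i)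
  -- Running maxima replace the dominating sequences by increasing ones with the same supremum, so
  -- that suprema commute with the finite sum over `i`.
  choose u hu using fun i => exists_eval_eq_partialSups (h i)
  have hu0 : ∀ i k s ω, 0 ≤ (u i k).eval s ω := fun i k s ω => by
    rw [hu]
    exact (abs_nonneg _).trans (le_partialSups_of_le (fun j => |(h i j).eval s ω|) (Nat.zero_le k))
  have humono : ∀ i s ω, Monotone fun k => (u i k).eval s ω := fun i s ω k l hkl => by
    simp only [hu]
    exact (partialSups _).monotone hkl
  choose w hw using fun k => exists_eval_eq_sum Finset.univ fun i => u i k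
  have hw0 : ∀ k s ω, 0 ≤ (w k).eval s ω := fun k s ω => by
    rw [hw]; exact Finset.sum_nonneg fun i _ => hu0 i k s ω
  have hwmono : ∀ s ω, Monotone fun k => (w k).eval s ω := fun s ω k l hkl => by
    simp only [hw]
    exact Finset.sum_le_sum fun i _ => humono i s ω hkl
  choose c hc using fun k => exists_eval_eq_clamp Z (w k)
  have hcmean : ∀ k, mean μ X t (c k) ≤ ∑ _i : ι, ε := fun k => by
    refine mean_le_sum hA Finset.univ (fun i => u i k) (fun i _ => hu0 i k) (fun _ => ε)
      (fun i _ H hH => hmean i H (ae_of_all _ fun ω s _ => ?_)) (c k) fun s ω => ?_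
    · refine le_trans ?_ (ofReal_partialSups_abs_le (fun j => (h i j).eval s ω) k)
      rw [Real.enorm_eq_ofReal_abs, ← hu]
      exact ENNReal.ofReal_le_ofReal (hH s ω)
    · rw [hc, ← hw]
      exact (abs_clamp_le _ _).trans (abs_of_nonneg (hw0 k s ω)).le
  -- The excess of `Z` over `w k` decreases to zero in absolute value, so its mean tends to zero,
  -- while the clamped part has mean at most the sum of the `ε`.
  let f (k : ℕ) : ElementaryIntegrand 𝓕 := lin 1 Z (-1) (c k)
  have hf : ∀ k s ω, (f k).eval s ω = Z.eval s ω - clamp (Z.eval s ω) ((w k).eval s ω) :=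
    fun k s ω => by simp only [f, eval_lin, hc]; ring
  have hfmean : Tendsto (fun k => mean μ X t (f k)) atTop (𝓝 0) := by
    refine tendsto_mean_of_antitone_abs hX t (fun s ω k l hkl => ?_) ?_
    · simp only [hf, abs_sub_clamp, abs_of_nonneg (hw0 _ _ _)]
      exact max_le_max_left _ (sub_le_sub_left (hwmono s ω hkl) _)
    · filter_upwards [hZ, ae_all_iff.2 hdom] with ω hω1 hω2 s hs
      simp only [hf]
      refine tendsto_sub_clamp_of_enorm_le (hwmono s ω) (fun k => hw0 k s ω) ?_
      have h1 : ∀ i, ‖F i s ω‖ₑ ≤ ⨆ k, ENNReal.ofReal ((u i k).eval s ω) := fun i => by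
        refine (hω2 i s hs).trans (iSup_mono fun k => ?_)
        rw [Real.enorm_eq_ofReal_abs, hu]
        exact ENNReal.ofReal_le_ofReal (le_partialSups (fun j => |(h i j).eval s ω|) k)
      calc ‖Z.eval s ω‖ₑ ≤ ENNReal.ofReal (∑ i, |F i s ω|) := by
            rw [Real.enorm_eq_ofReal_abs]
            exact ENNReal.ofReal_le_ofReal (hω1 s hs)
        _ = ∑ i, ‖F i s ω‖ₑ := by
            rw [ENNReal.ofReal_sum_of_nonneg fun _ _ => abs_nonneg _]
            simp only [Real.enorm_eq_ofReal_abs]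
        _ ≤ ∑ i, ⨆ k, ENNReal.ofReal ((u i k).eval s ω) := Finset.sum_le_sum fun i _ => h1 i
        _ = ⨆ k, ∑ i, ENNReal.ofReal ((u i k).eval s ω) :=
            ENNReal.finsetSum_iSup_of_monotone fun i k l hkl =>
              ENNReal.ofReal_le_ofReal (humono i s ω hkl)
        _ = ⨆ k, ENNReal.ofReal ((w k).eval s ω) := by
            refine iSup_congr fun k => ?_
            rw [hw, ENNReal.ofReal_sum_of_nonneg fun i _ => hu0 i k s ω]
  have hlim := hfmean.add_const (∑ _i : ι, ε)
  rw [zero_add] at hlim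
  refine ge_of_tendsto' hlim fun k => ?_
  exact (mean_le_add hA (L := Z) (H := f k) (K := c k) fun s ω => by simp [f]).trans
    (by linarith [hcmean k])

/-- Stochastic integrals of processes that add up to zero add up to zero. -/
theorem sum_hasStochIntegral_eq_zero (hX : IsSemimartingale μ 𝓕 X) {ι : Type*} [Fintype ι]
    {F : ι → ℝ≥0 → Ω → ℝ} {I : ι → Ω → ℝ} (h : ∀ i, HasStochIntegral μ 𝓕 X (F i) t (I i))
    (hF : ∀ᵐ ω ∂μ, ∀ s, ∑ i, F i s ω = 0) : ∀ᵐ ω ∂μ, ∑ i, I i ω = 0 := by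
  choose H hH hI using h
  choose Z hZ using fun n => exists_eval_eq_sum Finset.univ fun i => H i n
  have hmean : Tendsto (fun n => mean μ X t (Z n)) atTop (𝓝 0) := by
    refine tendsto_order.2 ⟨fun a ha => Eventually.of_forall fun j => ha.trans_le (mean_nonneg _),
      fun ε hε => ?_⟩
    -- The extra `1` makes the final inequality strict and covers an empty index type.
    set δ := ε / (Fintype.card ι + 1)
    have hδ : 0 < δ := by positivity
    have hev : ∀ i, ∀ᶠ n in atTop,
        daniellMean μ 𝓕 X t (fun s ω => F i s ω - (H i n).eval s ω) < ENNReal.ofReal δ := fun i =>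
      (hH i).eventually_lt_const (by simpa using hδ)
    filter_upwards [eventually_all.2 hev] with n hn
    refine (mean_le_of_dominated_sum hX hn (Z := Z n) ?_).trans_lt ?_
    · filter_upwards [hF] with ω hω s _
      have : (Z n).eval s ω = -∑ i, (F i s ω - (H i n).eval s ω) := by
        rw [Finset.sum_sub_distrib, hω s, hZ]
        ring
      rw [this, abs_neg]
      exact Finset.abs_sum_le_sum_abs _ _
    · rw [Finset.sum_const, nsmul_eq_mul, Finset.card_univ]
      have : δ * (Fintype.card ι + 1) = ε := div_mul_cancel₀ _ (by positivity)
      linarith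
  have hzero := tendstoInMeasure_zero_of_mean hX.adapted hmean
  have hsum := tendstoInMeasure_sum Finset.univ hI
  have heq : (fun n ω => ∑ i, (H i n).integral X t ω) = fun n => (Z n).integral X t := by
    funext n ω
    have hlin : ∀ (s : Finset ι) (L : ElementaryIntegrand 𝓕),
        (∀ s' ω, L.eval s' ω = ∑ i ∈ s, (H i n).eval s' ω) →
          L.integral X t ω = ∑ i ∈ s, (H i n).integral X t ω := by
      classical
      intro s
      induction s using Finset.induction_on with
      | empty => exact fun L hL => by simpa using integral_eq_zero (fun s' _ => by simpa using hL s' ω) X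
      | insert a s ha ih =>
        intro L hL
        obtain ⟨K, hK⟩ := exists_eval_eq_sum s fun i => H i n
        rw [Finset.sum_insert ha, ← ih K hK,
          integral_lin_of_eval (H := H a n) (K := K) (a := 1) (b := 1) fun s' _ => by
            rw [hL, hK, Finset.sum_insert ha]; ring]
        ring
    exact (hlin Finset.univ (Z n) (hZ n)).symm
  rw [heq] at hsum
  exact tendstoInMeasure_ae_unique hsum hzero

end Uniqueness

/-! ### Pools and the execution of trades -/

section MeasurableLists

variable {α : Type*} [MeasurableSpace α]

lemma measurable_sigma_mk_fin (k : ℕ) :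
    Measurable fun g : Fin k → α => (⟨k, g⟩ : Σ k : ℕ, Fin k → α) :=
  Measurable.of_le_map (iInf_le _ k)

lemma measurable_list_singleton : Measurable fun a : α => [a] := by
  refine measurable_comap_iff.2 ?_
  have : (fun l : List α => (⟨l.length, l.get⟩ : Σ k : ℕ, Fin k → α)) ∘ (fun a => [a])
      = (fun g : Fin 1 → α => (⟨1, g⟩ : Σ k : ℕ, Fin k → α)) ∘ fun a _ => a := by
    funext a
    refine Sigma.ext rfl (heq_of_eq (funext fun i => ?_))
    simp
  rw [this]
  exact (measurable_sigma_mk_fin 1).comp (measurable_pi_lambda _ fun _ => measurable_id)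

lemma measurable_freeMonoid_of : Measurable (FreeMonoid.of : α → FreeMonoid α) :=
  measurable_comap_iff.2 measurable_list_singleton

end MeasurableLists

namespace LiquidityPool

variable {St A : Type*} [MeasurableSpace St] [MeasurableSpace A] (pool : LiquidityPool St A)

lemma value_one (p : ℝ) : pool.value p 1 = 0 := by simp [value, pool.payoff_one]

lemma value_mul (p : ℝ) (v w : FreeMonoid A) :
    pool.value p (v * w) = pool.value p v + pool.value p w := by
  simp only [value, pool.payoff_mul, Prod.fst_add, Prod.snd_add]
  ring

/-- The value of the optimal action. -/
noncomputable def optValue (p : ℝ) (s : St) : ℝ := pool.value p (FreeMonoid.of (pool.opt s p))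

lemma value_le_optValue {p : ℝ} (hp : 0 < p) {s : St} {w : FreeMonoid A} (hw : w ∈ pool.adm s) :
    pool.value p w ≤ pool.optValue p s :=
  pool.opt_max s p hp w hw

lemma optValue_nonneg {p : ℝ} (hp : 0 < p) (s : St) : 0 ≤ pool.optValue p s := by
  rw [← pool.value_one p]
  exact pool.value_le_optValue hp (pool.one_mem_adm s)

/-- An action that still had value after `w` could be appended to `w`, which would then not be
maximal. -/
lemma isNoArbitrage_trans {p : ℝ} {s : St} {w : FreeMonoid A} (hw : w ∈ pool.adm s)
    (hmax : ∀ v ∈ pool.adm s, pool.value p v ≤ pool.value p w) :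
    pool.IsNoArbitrage p (pool.trans s w) := fun v hv => by
  have := hmax _ (pool.mul_mem_adm s w v hw hv)
  rw [value_mul] at this
  linarith

lemma isNoArbitrage_trans_opt {p : ℝ} (hp : 0 < p) (s : St) :
    pool.IsNoArbitrage p (pool.trans s (FreeMonoid.of (pool.opt s p))) :=
  pool.isNoArbitrage_trans (pool.opt_mem_adm s p hp) fun _ hv => pool.value_le_optValue hp hv

variable {ι : Type*}

lemma mem_of_mem_execute {s : St} {l : List (ι × FreeMonoid A)} {e : ι × FreeMonoid A}
    (h : e ∈ pool.execute s l) : e ∈ l := by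
  induction l generalizing s with
  | nil => simp [execute] at h
  | cons a l ih =>
    unfold execute at h
    split_ifs at h with ha
    · rcases List.mem_cons.1 h with h | h
      · exact h ▸ List.mem_cons_self
      · exact List.mem_cons_of_mem _ (ih h)
    · exact List.mem_cons_of_mem _ (ih h)

/-- The composition of the executed trades is one admissible action. -/
lemma exists_mem_adm_execute (p : ℝ) (s : St) (l : List (ι × FreeMonoid A)) :
    ∃ w ∈ pool.adm s, ((pool.execute s l).map fun e => pool.value p e.2).sum = pool.value p w := by
  induction l generalizing s with
  | nil => exact ⟨1, pool.one_mem_adm s, by simp [execute, value_one]⟩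
  | cons a l ih =>
    unfold execute
    split_ifs with ha
    · obtain ⟨w, hw, hsum⟩ := ih (pool.trans s a.2)
      exact ⟨a.2 * w, pool.mul_mem_adm s _ _ ha hw, by simp [value_mul, hsum]⟩
    · exact ih s

/-- In a no-arbitrage state only trades without value are executed, among trades whose value is
nonnegative. -/
lemma execute_of_isNoArbitrage {p : ℝ} {s : St} (hs : pool.IsNoArbitrage p s)
    {l : List (ι × FreeMonoid A)} (hl : ∀ e ∈ l, 0 ≤ pool.value p e.2) :
    (∀ e ∈ pool.execute s l, pool.value p e.2 = 0) ∧
      pool.IsNoArbitrage p (pool.stateAfter s (pool.execute s l)) := by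
  induction l generalizing s with
  | nil => exact ⟨by simp [execute], by simpa [execute, stateAfter] using hs⟩
  | cons a l ih =>
    have hl' : ∀ e ∈ l, 0 ≤ pool.value p e.2 := fun e he => hl e (List.mem_cons_of_mem _ he)
    unfold execute
    split_ifs with ha
    · have h0 : pool.value p a.2 = 0 := le_antisymm (hs _ ha) (hl a List.mem_cons_self)
      obtain ⟨h1, h2⟩ := ih (s := pool.trans s a.2) (pool.isNoArbitrage_trans ha fun v hv => by
        rw [h0]; exact hs v hv) hl'
      refine ⟨fun e he => ?_, by simpa [stateAfter] using h2⟩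
      rcases List.mem_cons.1 he with rfl | he
      · exact h0
      · exact h1 e he
    · exact ih hs hl'

lemma isNoArbitrage_optState {Ω : Type*} {P : ℝ≥0 → Ω → ℝ} (hP : ∀ t ω, 0 < P t ω) (τ : ℕ → ℝ≥0)
    (n : ℕ) (ω : Ω) : pool.IsNoArbitrage (P (τ n) ω) (pool.optState P τ (n + 1) ω) :=
  pool.isNoArbitrage_trans_opt (hP _ _) _

lemma measurable_optState {Ω : Type*} {m : MeasurableSpace Ω} {P : ℝ≥0 → Ω → ℝ} {τ : ℕ → ℝ≥0} :
    ∀ n, (∀ k < n, Measurable (P (τ k))) → Measurable (pool.optState P τ n)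
  | 0, _ => measurable_const
  | n + 1, h => by
    have ih := measurable_optState n fun k hk => h k (hk.trans n.lt_succ_self)
    exact pool.measurable_trans.comp
      (ih.prodMk (pool.measurable_opt.comp (ih.prodMk (h n n.lt_succ_self))))

lemma measurable_optValue {Ω : Type*} {m : MeasurableSpace Ω} {s : Ω → St} {p : Ω → ℝ}
    (hs : Measurable s) (hp : Measurable p) : Measurable fun ω => pool.optValue (p ω) (s ω) := by
  have h := pool.measurable_payoff.comp (pool.measurable_opt.comp (hs.prodMk hp))
  exact (h.fst.mul hp).add h.snd

end LiquidityPool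

/-- The number of blocks up to time `t`. -/
noncomputable def blockCount (τ : ℕ → ℝ≥0) (t : ℝ≥0) : ℕ := sInf {n | t < τ n}

lemma IsBlockTimes.le_iff_lt_blockCount {τ : ℕ → ℝ≥0} (hτ : IsBlockTimes τ) (t : ℝ≥0) (n : ℕ) :
    τ n ≤ t ↔ n < blockCount τ t := by
  have hne : {n | t < τ n}.Nonempty := (hτ.unbounded.eventually_gt_atTop t).exists
  constructor
  · intro h
    by_contra hcon
    exact absurd ((show t < τ (blockCount τ t) from Nat.sInf_mem hne).trans_le
      (hτ.strictMono.monotone (not_lt.1 hcon))) (not_lt.2 h)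
  · intro h
    exact not_lt.1 fun h' => absurd (Nat.sInf_le (s := {n | t < τ n}) h') (not_le.2 h)

lemma sum_sum_filter_eq_sum {A : Type*} {m : ℕ} {l : List (Option (Fin m) × FreeMonoid A)}
    (hl : ∀ e ∈ l, e.1 ≠ none) (f : FreeMonoid A → ℝ) :
    ∑ i : Fin m, ((l.filter fun e => e.1 = some i).map fun e => f e.2).sum
      = (l.map fun e => f e.2).sum := by
  induction l with
  | nil => simp
  | cons a l ih =>
    obtain ⟨i, hi⟩ := Option.ne_none_iff_exists'.1 (hl a List.mem_cons_self)
    rw [List.map_cons, List.sum_cons, ← ih fun e he => hl e (List.mem_cons_of_mem _ he)]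
    have h1 : ∀ j : Fin m, (((a :: l).filter fun e => e.1 = some j).map fun e => f e.2).sum
        = (if i = j then f a.2 else 0) + ((l.filter fun e => e.1 = some j).map fun e => f e.2).sum :=
      fun j => by
        by_cases hij : i = j
        · simp [hi, hij]
        · simp [hi, hij]
    simp only [h1, Finset.sum_add_distrib, Finset.sum_ite_eq, Finset.mem_univ, if_true]

/-! ### Accounting in a competitive family and the upper bound. -/

namespace BlockchainMarket

variable {Ω St A : Type*} [mΩ : MeasurableSpace Ω] [MeasurableSpace St] [MeasurableSpace A]
  {μ : Measure Ω} {pool : LiquidityPool St A} {P : ℝ≥0 → Ω → ℝ} {τ : ℕ → ℝ≥0}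

/-- The PNL of the simple arbitrage strategy when it is uncontested. -/
noncomputable def arbitragePNL (pool : LiquidityPool St A) (P : ℝ≥0 → Ω → ℝ) (τ : ℕ → ℝ≥0)
    (t : ℝ≥0) (ω : Ω) : ℝ :=
  ∑ n ∈ Finset.range (blockCount τ t), pool.optValue (P (τ n) ω) (pool.optState P τ n ω)

variable (B : BlockchainMarket μ pool P τ) {m : ℕ}

lemma state_succ (W : World Ω A m) (n : ℕ) (ω : Ω) :
    B.state W (n + 1) ω = pool.stateAfter (B.state W n ω) (B.executed W n ω) := rfl

lemma measurable_price (t : ℝ≥0) : Measurable[B.filt t] (P t) := B.semimartingale.adapted t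

/-- The permutation lives on `Fin` of the length of the submitted list, so lists are identified with
pairs of a length and a tuple to transport it. -/
lemma ordered_eq_ofFn {W : World Ω A m} {n : ℕ} {ω : Ω} {k : ℕ}
    {g : Fin k → Option (Fin m) × FreeMonoid A} (h : W.submitted n ω = List.ofFn g) :
    B.ordered W n ω = List.ofFn fun j => g (B.draw n k (fun i => (g i).2) ω j) := by
  let Φ (p : Σ k, Fin k → Option (Fin m) × FreeMonoid A) : List (Option (Fin m) × FreeMonoid A) :=
    List.ofFn fun j => p.2 (B.draw n p.1 (fun i => (p.2 i).2) ω j)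
  have h1 : List.equivSigmaTuple (W.submitted n ω) = ⟨k, g⟩ := by
    rw [h]
    exact List.equivSigmaTuple.apply_symm_apply ⟨k, g⟩
  exact congrArg Φ h1

lemma mem_submitted_of_mem_executed {W : World Ω A m} {n : ℕ} {ω : Ω}
    {e : Option (Fin m) × FreeMonoid A} (h : e ∈ B.executed W n ω) : e ∈ W.submitted n ω := by
  have h1 := pool.mem_of_mem_execute h
  obtain ⟨j, rfl⟩ := (List.mem_ofFn' _ _).1 h1
  exact List.get_mem _ _

lemma covering_of_others_eq_nil {W : World Ω A m} (h : ∀ n ω, W.others n ω = []) :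
    B.Covering W := fun n => ae_of_all _ fun ω e he => by
  have h1 := B.mem_submitted_of_mem_executed he
  rw [World.submitted, h] at h1
  simp only [List.map_nil, List.nil_append, List.mem_flatMap, List.mem_map] at h1
  obtain ⟨i, -, w, -, rfl⟩ := h1
  simp

/-- The total PNL of a complete family is the total value of all executed trades. -/
lemma totalPNL_eq_sum_value [IsProbabilityMeasure μ] (hτ : IsBlockTimes τ) {W : World Ω A m}
    (hW : B.IsValid W) (hc : B.Complete W) (t : ℝ≥0) :
    ∀ᵐ ω ∂μ, W.totalPNL P t ω = ∑ n ∈ Finset.range (blockCount τ t),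
      ((B.executed W n ω).map fun e => pool.value (P (τ n) ω) e.2).sum := by
  choose I hI hpnl using fun i => hW.selfFinancing i t _ (hτ.le_iff_lt_blockCount t)
  have hsum := sum_hasStochIntegral_eq_zero B.semimartingale hI hc.2
  filter_upwards [hsum, ae_all_iff.2 hpnl, ae_all_iff.2 hc.1] with ω h1 h2 h3
  calc W.totalPNL P t ω
      = ∑ i, (I i ω + ∑ n ∈ Finset.range (blockCount τ t), B.blockGain W i n ω) :=
        Finset.sum_congr rfl fun i _ => h2 i
    _ = _ := by
        rw [Finset.sum_add_distrib, h1, zero_add, Finset.sum_comm]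
        exact Finset.sum_congr rfl fun n _ => sum_sum_filter_eq_sum (h3 n) _

/-- Both states are no-arbitrage states for the price of the last block, hence equal. What happened
in earlier blocks does not matter. -/
lemma state_eq_optState (hpool : pool.Frictionless) (hP : ∀ t ω, 0 < P t ω) {W : World Ω A m}
    {ω : Ω} (h : ∀ n, pool.IsNoArbitrage (P (τ n) ω) (B.state W (n + 1) ω)) :
    ∀ n, B.state W n ω = pool.optState P τ n ω
  | 0 => rfl
  | n + 1 => (hpool _ (hP (τ n) ω)).unique (h n) (pool.isNoArbitrage_optState hP τ n ω)

lemma totalPNL_le_arbitragePNL [IsProbabilityMeasure μ] (hpool : pool.Frictionless)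
    (hP : ∀ t ω, 0 < P t ω) (hτ : IsBlockTimes τ) {W : World Ω A m} (hW : B.IsCompetitive W)
    (t : ℝ≥0) : ∀ᵐ ω ∂μ, W.totalPNL P t ω ≤ arbitragePNL pool P τ t ω := by
  filter_upwards [B.totalPNL_eq_sum_value hτ hW.valid hW.complete t,
    ae_all_iff.2 hW.noArbitrage] with ω h1 h2
  rw [h1]
  refine Finset.sum_le_sum fun n _ => ?_
  rw [← B.state_eq_optState hpool hP h2 n]
  obtain ⟨w, hw, hsum⟩ :=
    pool.exists_mem_adm_execute (P (τ n) ω) (B.state W n ω) (B.ordered W n ω)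
  rw [executed, hsum]
  exact pool.value_le_optValue (hP _ _) hw

/-- If every trade submitted for a block is the optimal action, then the first trade in the order
of execution takes all the value. -/
lemma executed_of_forall_opt {k : ℕ} (hP : ∀ t ω, 0 < P t ω) {W : World Ω A m} {n : ℕ} {ω : Ω}
    {g : Fin (k + 1) → Option (Fin m)}
    (h : W.submitted n ω =
      List.ofFn fun i => (g i, FreeMonoid.of (pool.opt (B.state W n ω) (P (τ n) ω)))) :
    (∃ l : List (Option (Fin m) × FreeMonoid A), B.executed W n ω =
        (g (B.draw n (k + 1) (fun _ => FreeMonoid.of (pool.opt (B.state W n ω) (P (τ n) ω))) ω 0),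
          FreeMonoid.of (pool.opt (B.state W n ω) (P (τ n) ω))) :: l ∧
        ∀ e ∈ l, pool.value (P (τ n) ω) e.2 = 0) ∧
      pool.IsNoArbitrage (P (τ n) ω) (B.state W (n + 1) ω) := by
  have hadm := pool.opt_mem_adm (B.state W n ω) (P (τ n) ω) (hP _ _)
  have hNA := pool.isNoArbitrage_trans_opt (hP (τ n) ω) (B.state W n ω)
  have hval : 0 ≤ pool.value (P (τ n) ω) (FreeMonoid.of (pool.opt (B.state W n ω) (P (τ n) ω))) :=
    pool.optValue_nonneg (hP _ _) _
  have heq := B.ordered_eq_ofFn h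
  dsimp only at heq
  rw [List.ofFn_succ] at heq
  set a := FreeMonoid.of (pool.opt (B.state W n ω) (P (τ n) ω))
  set σ := B.draw n (k + 1) (fun _ => a) ω
  have hex : B.executed W n ω = (g (σ 0), a) :: pool.execute (pool.trans (B.state W n ω) a)
      (List.ofFn fun j : Fin k => (g (σ j.succ), a)) := by
    rw [executed, heq, LiquidityPool.execute, if_pos hadm]
  have hexec := pool.execute_of_isNoArbitrage hNA
    (l := List.ofFn fun j : Fin k => (g (σ j.succ), a)) fun e he => by
      obtain ⟨j, rfl⟩ := (List.mem_ofFn' _ _).1 he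
      exact hval
  refine ⟨⟨_, hex, hexec.1⟩, ?_⟩
  rw [state_succ, hex]
  exact hexec.2

end BlockchainMarket

/-- The σ-algebras are variables, because this is applied with `B.filt (τ n)` on `Ω`. -/
lemma measurable_comp_graph {Ω β γ : Type*} {_ : MeasurableSpace Ω} {_ : MeasurableSpace β}
    {_ : MeasurableSpace γ} {f : β × Ω → γ} (hf : Measurable f) {T : Ω → β} (hT : Measurable T) :
    Measurable fun ω => f (T ω, ω) :=
  hf.comp (hT.prodMk measurable_id)

namespace BlockchainMarket

section OptWorld

variable {Ω St A : Type*} [MeasurableSpace St] [MeasurableSpace A]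

/-- The submission of the optimal action in every block. -/
def optTrades (pool : LiquidityPool St A) (P : ℝ≥0 → Ω → ℝ) (τ : ℕ → ℝ≥0) (n : ℕ) (ω : Ω) :
    List (FreeMonoid A) :=
  [FreeMonoid.of (pool.opt (pool.optState P τ n ω) (P (τ n) ω))]

/-- The world in which `m` strategies submit the optimal action in every block, with holdings of
the numéraire given by `y`. -/
def optWorld (pool : LiquidityPool St A) (P : ℝ≥0 → Ω → ℝ) (τ : ℕ → ℝ≥0) (m : ℕ)
    (y : Fin m → ℝ≥0 → Ω → ℝ) : World Ω A m where
  strat i := { x := fun _ _ => 0, y := y i, trades := optTrades pool P τ }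
  others _ _ := []

lemma submitted_optWorld (pool : LiquidityPool St A) (P : ℝ≥0 → Ω → ℝ) (τ : ℕ → ℝ≥0) {m : ℕ}
    (y : Fin m → ℝ≥0 → Ω → ℝ) (n : ℕ) (ω : Ω) :
    (optWorld pool P τ m y).submitted n ω = List.ofFn fun i : Fin m =>
      (some i, FreeMonoid.of (pool.opt (pool.optState P τ n ω) (P (τ n) ω))) := by
  simp only [World.submitted, optWorld, optTrades, List.map_nil, List.nil_append, List.map_cons,
    ← List.map_eq_flatMap, List.ofFn_eq_map]

end OptWorld

variable {Ω St A : Type*} [mΩ : MeasurableSpace Ω] [MeasurableSpace St] [MeasurableSpace A]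
  {μ : Measure Ω} {pool : LiquidityPool St A} {P : ℝ≥0 → Ω → ℝ} {τ : ℕ → ℝ≥0}
  (B : BlockchainMarket μ pool P τ) {m : ℕ}

/-- All trades submitted on the path `ω` are optimal actions, and in every block there is one. -/
def AllOptimal (W : World Ω A m) (ω : Ω) : Prop :=
  ∀ n, ∃ (k : ℕ) (g : Fin (k + 1) → Option (Fin m)), W.submitted n ω =
    List.ofFn fun i => (g i, FreeMonoid.of (pool.opt (B.state W n ω) (P (τ n) ω)))

variable {B} in
lemma AllOptimal.isNoArbitrage (hP : ∀ t ω, 0 < P t ω) {W : World Ω A m} {ω : Ω}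
    (h : B.AllOptimal W ω) (n : ℕ) : pool.IsNoArbitrage (P (τ n) ω) (B.state W (n + 1) ω) := by
  obtain ⟨k, g, hg⟩ := h n
  exact (B.executed_of_forall_opt hP hg).2

lemma totalPNL_eq_arbitragePNL [IsProbabilityMeasure μ] (hpool : pool.Frictionless)
    (hP : ∀ t ω, 0 < P t ω) (hτ : IsBlockTimes τ) {W : World Ω A m} (hW : B.IsValid W)
    (hc : B.Complete W) (hopt : ∀ᵐ ω ∂μ, B.AllOptimal W ω) (t : ℝ≥0) :
    ∀ᵐ ω ∂μ, W.totalPNL P t ω = arbitragePNL pool P τ t ω := by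
  filter_upwards [B.totalPNL_eq_sum_value hτ hW hc t, hopt] with ω h1 h2
  rw [h1]
  refine Finset.sum_congr rfl fun n _ => ?_
  rw [← B.state_eq_optState hpool hP (h2.isNoArbitrage hP) n]
  obtain ⟨k, g, hg⟩ := h2 n
  obtain ⟨⟨l, hl, hzero⟩, -⟩ := B.executed_of_forall_opt hP hg
  rw [hl, List.map_cons, List.sum_cons, List.map_congr_left (g := fun _ => (0 : ℝ)) hzero]
  simp [LiquidityPool.optValue]

lemma measurable_arbitragePNL (hprice : ∀ s, Measurable (P s)) (t : ℝ≥0) :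
    Measurable (arbitragePNL pool P τ t) :=
  Finset.measurable_fun_sum _ fun n _ =>
    pool.measurable_optValue (pool.measurable_optState n fun _ _ => hprice _) (hprice _)

/-! ### The simple arbitrage strategy run uncontested -/

lemma IsSimpleArbitrageAlone.pnl_eq [IsProbabilityMeasure μ] (hpool : pool.Frictionless)
    (hP : ∀ t ω, 0 < P t ω) (hτ : IsBlockTimes τ) {S : TradingStrategy Ω A}
    (hS : B.IsSimpleArbitrageAlone S) (t : ℝ≥0) :
    ∀ᵐ ω ∂μ, S.pnl P t ω = arbitragePNL pool P τ t ω := by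
  have hc : B.Complete (World.alone S) := by
    refine ⟨B.covering_of_others_eq_nil fun _ _ => rfl, ?_⟩
    filter_upwards [hS.isArbitrage] with ω hω t
    simpa [TradingStrategy.sum, World.alone] using hω t
  have hopt : ∀ᵐ ω ∂μ, B.AllOptimal (World.alone S) ω := by
    filter_upwards [ae_all_iff.2 hS.trades_eq] with ω hω n
    refine ⟨0, fun _ => some 0, ?_⟩
    simp [World.submitted, World.alone, hω n, List.finRange_succ]
  filter_upwards [B.totalPNL_eq_arbitragePNL hpool hP hτ hS.valid hc hopt t] with ω hω
  simpa [World.totalPNL, World.alone] using hω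

/-! ### The competitive family in which everybody submits the optimal action -/

/-- The on-chain gains up to time `t` of the members of `optWorld`. -/
noncomputable def optGains (m : ℕ) (i : Fin m) (t : ℝ≥0) (ω : Ω) : ℝ :=
  ∑ n ∈ Finset.range (blockCount τ t), B.blockGain (optWorld pool P τ m fun _ _ _ => 0) i n ω

/-- The world in which `m` self-financing strategies submit the optimal action in every block. -/
noncomputable def competition (m : ℕ) : World Ω A m := optWorld pool P τ m (B.optGains m)

lemma state_optWorld (hpool : pool.Frictionless) (hP : ∀ t ω, 0 < P t ω) (hm : 0 < m)
    (y : Fin m → ℝ≥0 → Ω → ℝ) (n : ℕ) (ω : Ω) :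
    -- Here the induction is needed: the submitted trades are optimal for `optState`, and must be so
    -- for the actual state.
    B.state (optWorld pool P τ m y) n ω = pool.optState P τ n ω := by
  obtain ⟨k, rfl⟩ : ∃ k, m = k + 1 := ⟨m - 1, by omega⟩
  induction n with
  | zero => rfl
  | succ n ih =>
    refine (hpool _ (hP (τ n) ω)).unique (B.executed_of_forall_opt hP (k := k)
      (g := fun i => some i) ?_).2 (pool.isNoArbitrage_optState hP τ n ω)
    rw [submitted_optWorld, ih]

lemma allOptimal_optWorld (hpool : pool.Frictionless) (hP : ∀ t ω, 0 < P t ω) (hm : 0 < m)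
    (y : Fin m → ℝ≥0 → Ω → ℝ) (ω : Ω) : B.AllOptimal (optWorld pool P τ m y) ω := fun n => by
  rw [B.state_optWorld hpool hP hm, submitted_optWorld]
  obtain ⟨k, rfl⟩ : ∃ k, m = k + 1 := ⟨m - 1, by omega⟩
  exact ⟨k, fun i => some i, rfl⟩

/-- The winner is whoever submitted the trade that the draw puts first. In particular the gains do
not depend on `y`, so taking `y` to be the gains computed with `y = 0`, as in `competition`, is not
circular. -/
lemma blockGain_optWorld (hpool : pool.Frictionless) (hP : ∀ t ω, 0 < P t ω) (hm : 0 < m)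
    (y : Fin m → ℝ≥0 → Ω → ℝ) (i : Fin m) (n : ℕ) (ω : Ω) :
    B.blockGain (optWorld pool P τ m y) i n ω =
      if B.draw n m (fun _ => FreeMonoid.of (pool.opt (pool.optState P τ n ω) (P (τ n) ω))) ω
          ⟨0, hm⟩ = i
      then pool.optValue (P (τ n) ω) (pool.optState P τ n ω) else 0 := by
  have hstate := B.state_optWorld hpool hP hm y n ω
  obtain ⟨k, rfl⟩ : ∃ k, m = k + 1 := ⟨m - 1, by omega⟩
  obtain ⟨⟨l, hl, hzero⟩, -⟩ := B.executed_of_forall_opt hP (k := k)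
    (W := optWorld pool P τ (k + 1) y) (n := n) (ω := ω) (g := fun i => some i)
    (by rw [submitted_optWorld, hstate])
  rw [hstate] at hl
  have hsum : ((l.filter fun e => e.1 = some i).map fun e => pool.value (P (τ n) ω) e.2).sum
      = 0 := by
    rw [List.map_congr_left (g := fun _ => (0 : ℝ)) fun e he => hzero e (List.mem_of_mem_filter he)]
    simp
  have hfirst : (⟨0, hm⟩ : Fin (k + 1)) = 0 := rfl
  rw [blockGain, hl, List.filter_cons, hfirst]
  by_cases h : B.draw n (k + 1)
      (fun _ => FreeMonoid.of (pool.opt (pool.optState P τ n ω) (P (τ n) ω))) ω 0 = i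
  · rw [if_pos (decide_eq_true (congrArg some h)), if_pos h, List.map_cons, List.sum_cons, hsum, add_zero]
    rfl
  · rw [if_neg (fun h' => h (Option.some_injective _ (of_decide_eq_true h'))), if_neg h, hsum]

lemma measurable_optState_info (hτ : IsBlockTimes τ) (n : ℕ) :
    Measurable[B.info n] (pool.optState P τ n) :=
  pool.measurable_optState n fun k hk =>
    (B.measurable_price (τ k)).mono (B.le_info n (τ k) (hτ.strictMono hk)) le_rfl

lemma measurable_opt_info (hτ : IsBlockTimes τ) (n : ℕ) :
    Measurable[B.info n] fun ω =>
      FreeMonoid.of (pool.opt (pool.optState P τ n ω) (P (τ n) ω)) :=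
  measurable_freeMonoid_of.comp
    (pool.measurable_opt.comp ((B.measurable_optState_info hτ n).prodMk (B.price_info n)))

lemma measurable_draw_comp (n : ℕ) {k : ℕ} {T : Ω → Fin k → FreeMonoid A}
    (hT : Measurable[B.filt (τ n)] T) :
    Measurable[B.filt (τ n)] fun ω => B.draw n k (T ω) ω :=
  measurable_comp_graph (B.measurable_draw n k) hT

lemma measurable_blockGain_optWorld (hpool : pool.Frictionless) (hP : ∀ t ω, 0 < P t ω)
    (hτ : IsBlockTimes τ) (hm : 0 < m) (y : Fin m → ℝ≥0 → Ω → ℝ) (i : Fin m) (n : ℕ) :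
    Measurable[B.filt (τ n)] (B.blockGain (optWorld pool P τ m y) i n) := by
  have hfun := funext (B.blockGain_optWorld hpool hP hm y i n)
  rw [hfun]
  have hdraw : Measurable[B.filt (τ n)] fun ω => B.draw n m
      (fun _ => FreeMonoid.of (pool.opt (pool.optState P τ n ω) (P (τ n) ω))) ω := by
    exact B.measurable_draw_comp n (@measurable_pi_lambda _ _ _ (B.filt (τ n)) _ _
      fun _ => (B.measurable_opt_info hτ n).mono (B.info_le n) le_rfl)
  have hset : MeasurableSet {σ : Equiv.Perm (Fin m) | σ ⟨0, hm⟩ = i} :=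
    MeasurableSpace.measurableSet_top
  refine Measurable.ite (hdraw hset) ?_ measurable_const
  exact (pool.measurable_optValue (B.measurable_optState_info hτ n) (B.price_info n)).mono
    (B.info_le n) le_rfl

lemma isValid_competition (hpool : pool.Frictionless) (hP : ∀ t ω, 0 < P t ω)
    (hτ : IsBlockTimes τ) (hm : 0 < m) : B.IsValid (B.competition m) where
  isStrategy i :=
    { predictable_x := stronglyMeasurable_const
      adapted_y := fun t => Finset.measurable_fun_sum _ fun n hn =>
        (B.measurable_blockGain_optWorld hpool hP hτ hm _ i n).mono
          (B.filt.mono ((hτ.le_iff_lt_blockCount t n).2 (Finset.mem_range.1 hn))) le_rfl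
      measurable_trades := fun n => measurable_list_singleton.comp (B.measurable_opt_info hτ n)
      integrable := fun t => by simp [competition, optWorld] }
  selfFinancing i t N hN := by
    refine ⟨fun _ => 0, hasStochIntegral_zero B.filt P t, ae_of_all _ fun ω => ?_⟩
    have hcount : N = blockCount τ t := eq_of_forall_lt_iff fun n => by
      rw [← hN, hτ.le_iff_lt_blockCount]
    -- No block happens at time `0`, so the strategies start with empty holdings.
    have hcount0 : blockCount τ 0 = 0 := by
      by_contra h
      have := (hτ.le_iff_lt_blockCount 0 0).2 (Nat.pos_of_ne_zero h)
      exact absurd hτ.pos (not_lt.2 this)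
    have hgain : ∀ (y : Fin m → ℝ≥0 → Ω → ℝ) n, B.blockGain (optWorld pool P τ m y) i n ω
        = B.blockGain (optWorld pool P τ m fun _ _ _ => 0) i n ω := fun y n => by
      rw [B.blockGain_optWorld hpool hP hm, B.blockGain_optWorld hpool hP hm]
    simp only [competition, hgain, hcount]
    simp [optWorld, optGains, hcount0]
  measurable_others _ := measurable_const

lemma complete_competition (m : ℕ) : B.Complete (B.competition m) :=
  ⟨B.covering_of_others_eq_nil fun _ _ => rfl,
    ae_of_all _ fun ω t => by simp [TradingStrategy.sum, competition, optWorld]⟩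

lemma isSimpleArbitrageAlone_competition (hpool : pool.Frictionless) (hP : ∀ t ω, 0 < P t ω)
    (hτ : IsBlockTimes τ) : B.IsSimpleArbitrageAlone ((B.competition 1).strat 0) := by
  have halone : World.alone ((B.competition 1).strat 0) = B.competition 1 := by
    simp only [World.alone, competition, optWorld, World.mk.injEq, and_true]
    funext i
    rw [Subsingleton.elim i 0]
  refine ⟨?_, ae_of_all _ fun _ _ => rfl, fun n => ae_of_all _ fun ω => ?_⟩
  · rw [halone]
    exact B.isValid_competition hpool hP hτ one_pos
  · rw [halone, competition, B.state_optWorld hpool hP one_pos]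
    rfl

lemma isCompetitive_competition (hpool : pool.Frictionless) (hP : ∀ t ω, 0 < P t ω)
    (hτ : IsBlockTimes τ) (hm : 0 < m)
    (hactive : m = 1 ∨ ∀ᵐ ω ∂μ, ∃ᶠ n in atTop,
      pool.opt (pool.optState P τ n ω) (P (τ n) ω) ≠ pool.null) :
    B.IsCompetitive (B.competition m) where
  valid := B.isValid_competition hpool hP hτ hm
  complete := B.complete_competition m
  noArbitrage n := ae_of_all _ fun ω =>
    (B.allOptimal_optWorld hpool hP hm (B.optGains m) ω).isNoArbitrage hP n
  active := by
    by_cases hm1 : m = 1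
    · exact Or.inl hm1
    right
    filter_upwards [hactive.resolve_left hm1] with ω hω
    have hsub : ∀ n i, pool.opt (pool.optState P τ n ω) (P (τ n) ω) ≠ pool.null →
        B.Submits (B.competition m) i n ω := fun n i hn => by
      refine ⟨_, List.mem_singleton_self _, ?_, fun hnull => hn (hnull _ ?_)⟩
      · rw [competition, B.state_optWorld hpool hP hm]
        exact pool.opt_mem_adm _ _ (hP _ _)
      · simp
    refine ⟨fun i => hω.exists.imp fun n hn => hsub n i hn, hω.mono fun n hn => ?_⟩
    -- For `m ≥ 2` two different members submit the same non-null action in each such block.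
    exact ⟨⟨0, hm⟩, ⟨1, by omega⟩, by simp, hsub n _ hn, hsub n _ hn⟩

end BlockchainMarket

end MEV

/-! ### The theorem. -/

theorem theorem1 {Ω St A : Type*} [MeasurableSpace Ω] [MeasurableSpace St] [MeasurableSpace A]
    (μ : Measure Ω) [IsProbabilityMeasure μ] (pool : MEV.LiquidityPool St A)
    (hpool : pool.Frictionless) (P : ℝ≥0 → Ω → ℝ) (hP : ∀ t ω, 0 < P t ω)
    (τ : ℕ → ℝ≥0) (hτ : MEV.IsBlockTimes τ) :
    ∃ V : ℝ≥0 → Ω → ℝ, ∀ B : MEV.BlockchainMarket μ pool P τ,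
      (∃ S₀, B.IsSimpleArbitrageAlone S₀) ∧
      (∀ S₀, B.IsSimpleArbitrageAlone S₀ → ∀ t, ∀ᵐ ω ∂μ, S₀.pnl P t ω = V t ω) ∧
      ∀ m : ℕ, 0 < m →
        (m = 1 ∨ ∀ᵐ ω ∂μ, ∃ᶠ n in atTop,
          pool.opt (pool.optState P τ n ω) (P (τ n) ω) ≠ pool.null) →
        B.IsPathwiseMEV m (fun t ω => ((V t ω : ℝ) : EReal)) ∧
        ∃ W : MEV.World Ω A m, B.IsCompetitive W ∧
          ∀ t, ∀ᵐ ω ∂μ, W.totalPNL P t ω = V t ω := by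
  refine ⟨MEV.BlockchainMarket.arbitragePNL pool P τ, fun B =>
    ⟨⟨_, B.isSimpleArbitrageAlone_competition hpool hP hτ⟩, fun S₀ hS₀ t => ?_,
      fun m hm hactive => ?_⟩⟩
  · exact MEV.BlockchainMarket.IsSimpleArbitrageAlone.pnl_eq B hpool hP hτ hS₀ t
  have hW := B.isCompetitive_competition hpool hP hτ hm hactive
  have hpnl := B.totalPNL_eq_arbitragePNL hpool hP hτ hW.valid hW.complete
    (ae_of_all _ (B.allOptimal_optWorld hpool hP hm (B.optGains m)))
  refine ⟨fun t => ⟨?_, fun k _ W hcomp => ?_, fun U _ hU => ?_⟩, _, hW, hpnl⟩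
  · exact (MEV.BlockchainMarket.measurable_arbitragePNL
      (fun s => (B.measurable_price s).mono (B.filt.le s) le_rfl) t).coe_real_ereal.aemeasurable
  · filter_upwards [B.totalPNL_le_arbitragePNL hpool hP hτ hcomp t] with ω hω
    exact EReal.coe_le_coe_iff.2 hω
  -- The supremum is attained by the family `W`, so every upper bound lies above `V`.
  · filter_upwards [hU m le_rfl _ hW, hpnl t] with ω h1 h2
    rwa [← h2]
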